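/- For a finite field $K$ of odd order $q$ and integers $n,s\ge 0$, let $\sigma_q(n,s)$ be the number of $s$-dimensional linear codes $C\subseteq K^n$ that are Euclidean self-orthogonal, i.e. $\sum_i v_iw_i=0$ for all $v,w\in C$. **(1)** Let $\mathtt R_2$ be a finite commutative chain ring whose maximal ideal $\langle\gamma\rangle$ has nilpotency index $2$ (so $\gamma\neq 0=\gamma^2$) and whose residue field $\mathtt R_1=\mathtt R_2/\langle\gamma\rangle\simeq\mathbb F_q$ has odd order $q$. Let $N_1,N_2\ge 0$ be integers. An $\mathtt R_2\mathtt R_1$-linear code of block-length $(N_1,N_2)$ is an $\mathtt R_2$-submodule $\mathscr C$ of $\mathtt R_2^{N_1}\oplus\mathtt R_1^{N_2}$; it is Euclidean self-dual if $\mathscr C=\mathscr C^{\perp_E}$, where $\mathscr C^{\perp_E}$ is the set of all $m$ with $\langle m,m'\rangle_E=0$ for every $m'\in\mathscr C$, and $\langle (c|d),(c'|d')\rangle_E=\sum_{i=1}^{N_1}c_ic_i'+\gamma\sum_{j=1}^{N_2}d_jd_j'\in\mathtt R_2$. A Euclidean self-dual $\mathtt R_2\mathtt R_1$-linear code of block-length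 $(N_1,N_2)$ exists if and only if $N_2$ is even and $(-1)^{N_2/2}$ is a square in $\mathbb F_q$. In that case the number of such codes is $$\sum_{k_0=0}^{\lfloor N_1/2\rfloor}\sigma_q(N_1,k_0)\,\sigma_q\!\left(N_2,\tfrac{N_2}{2}\right)q^{\frac{k_0}{2}(N_2+k_0-1)} .$$ **(2)** Let $p$ be an odd prime, let $GR(p^2,r)=\mathbb Z_{p^2}[x]/\langle h(x)\rangle$ with $h$ monic of degree $r$ and irreducible modulo $p$, let $1\le t\le k$, let $g(y)=y^k+p(g_{k-1}y^{k-1}+\dots+g_1y+g_0)\in GR(p^2,r)[y]$ with $g_0$ a unit, and let $\mathcal R_2=GR(p^2,r)[y]/\langle g(y),p\,y^t\rangle$. Each $a\in\mathcal R_2$ is represented by a polynomial $\sum_{i=0}^{k-1}\sum_{s=0}^{r-1}a_{i,s}x^sy^i$ whose coefficients $a_{i,s}$ are uniquely determined in $\mathbb Z_{p^2}$ for $i<t$ and in $\mathbb Z_p$ for $t\le i<k$. Let $\xi\in\mathbb C$ be a primitive $p^2$-th root of unity and put $$\chi_a(b)=\prod_{s=0}^{r-1}\Big(\prod_{i=0}^{t-1}\xi^{a_{i,s}b_{i,s}}\prod_{i=t}^{k-1}\xi^{p\,a_{i,s}b_{i,s}}\Big)\qquad(a,b\in\mathcal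 R_2).$$ An additive code of length $N\ge 0$ over $\mathcal R_2$ is an additive subgroup $\mathcal C$ of $\mathcal R_2^N$; it is self-dual if $\mathcal C=\{d\in\mathcal R_2^N:\prod_{\ell}\chi_{d_\ell}(c_\ell)=1\text{ for all }c\in\mathcal C\}$. Put $M_1=Nrt$ and $M_2=Nr(k-t)$. A self-dual additive code of length $N$ over $\mathcal R_2$ exists if and only if $M_2$ is even and $(-1)^{M_2/2}$ is a square in $\mathbb Z_p$. In that case the number of such codes is $$\sum_{k_0=0}^{\lfloor M_1/2\rfloor}\sigma_p(M_1,k_0)\,\sigma_p\!\left(M_2,\tfrac{M_2}{2}\right)p^{\frac{k_0}{2}(M_2+k_0-1)} .$$ **(3)** The numbers $\sigma_q(n,s)$ ($q$ odd) are given by $\sigma_q(n,0)=1$, by $\sigma_q(n,s)=0$ for $s>\lfloor n/2\rfloor$, and, for $1\le s\le\lfloor n/2\rfloor$, by $$\sigma_q(n,s)=\begin{cases}\dfrac{\prod_{i=0}^{s-1}(q^{\,n-1-2i}-1)}{\prod_{j=1}^{s}(q^j-1)}&\text{if } n \text{ is odd},\\[3mm] \dfrac{(q^{n-s}-\nu q^{\frac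 n2-s}+\nu q^{\frac n2}-1)\prod_{i=1}^{s-1}(q^{n-2i}-1)}{\prod_{j=1}^{s}(q^j-1)}&\text{if } n\text{ is even},\end{cases}$$ where $\nu=1$ if $(-1)^{n/2}$ is a square in $\mathbb F_q$ and $\nu=-1$ otherwise. -/

import Mathlib

open Polynomial

noncomputable section

namespace MixedCodes

/-! ### Euclidean self-orthogonal codes over a finite field -/

/-- A linear code of length `n` over a field `K` is Euclidean self-orthogonal if it is contained
in its dual with respect to the standard bilinear form. -/
def IsSelfOrthogonal {K : Type*} [Field K] {n : ℕ} (C : Submodule K (Fin n → K)) : Prop :=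
  ∀ v ∈ C, ∀ w ∈ C, ∑ i, v i * w i = 0

/-- `sigma K n s` is the number of Euclidean self-orthogonal codes of length `n` and dimension
`s` over the finite field `K`. -/
def sigma (K : Type*) [Field K] (n s : ℕ) : ℕ :=
  Nat.card {C : Submodule K (Fin n → K) // Module.finrank K C = s ∧ IsSelfOrthogonal C}

open Classical in
/-- The sign `ν`, equal to `1` if `(-1) ^ (n / 2)` is a square in `K` and to `-1` otherwise
(used for even `n` only). -/
def nu (K : Type*) [Field K] (n : ℕ) : ℚ :=
  if IsSquare ((-1 : K) ^ (n / 2)) then 1 else -1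

/-- The closed formula for `sigma K n s`, where `q = |K|`. In the last two cases `2 * s ≤ n`, so
that no exponent is a truncated difference. -/
def sigmaFormula (K : Type*) [Field K] (n s : ℕ) : ℚ :=
  let q : ℚ := (Nat.card K : ℚ)
  if s = 0 then 1
  else if n < 2 * s then 0
  else if Odd n then
    (∏ i ∈ Finset.range s, (q ^ (n - 1 - 2 * i) - 1)) / ∏ j ∈ Finset.Icc 1 s, (q ^ j - 1)
  else
    ((q ^ (n - s) - nu K n * q ^ (n / 2 - s) + nu K n * q ^ (n / 2) - 1)
        * ∏ i ∈ Finset.Icc 1 (s - 1), (q ^ (n - 2 * i) - 1))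
      / ∏ j ∈ Finset.Icc 1 s, (q ^ j - 1)

/-! ### Codes over the mixed alphabet `R₂R₁` -/

/-- `IsChainRingOfIndexTwo R γ`: the local ring `R` is a chain ring (its ideals are totally
ordered by inclusion) whose maximal ideal is generated by `γ` and has nilpotency index `2`. -/
structure IsChainRingOfIndexTwo (R : Type*) [CommRing R] [IsLocalRing R] (γ : R) : Prop where
  chain : ∀ I J : Ideal R, I ≤ J ∨ J ≤ I
  maximalIdeal_eq : IsLocalRing.maximalIdeal R = Ideal.span {γ}
  sq_eq_zero : γ ^ 2 = 0
  ne_zero : γ ≠ 0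

/-- The ambient `R`-module `R₂ ^ N₁ ⊕ R₁ ^ N₂`, where `R₂ = R` and where `R₁ = R ⧸ ⟨γ⟩` is the
residue field of `R`. -/
abbrev MixedSpace (R : Type*) [CommRing R] [IsLocalRing R] (N₁ N₂ : ℕ) : Type _ :=
  (Fin N₁ → R) × (Fin N₂ → IsLocalRing.ResidueField R)

/-- A representative in `R` of an element of the residue field. -/
def lift {R : Type*} [CommRing R] [IsLocalRing R] (x : IsLocalRing.ResidueField R) : R :=
  Function.surjInv IsLocalRing.residue_surjective x

/-- The Euclidean bilinear form `∑ cᵢ cᵢ' + γ ∑ dⱼ dⱼ'` with values in `R`. By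
`gamma_mul_lift_residue` the second term does not depend on representatives. -/
def euclForm {R : Type*} [CommRing R] [IsLocalRing R] (γ : R) {N₁ N₂ : ℕ}
    (m m' : MixedSpace R N₁ N₂) : R :=
  ∑ i, m.1 i * m'.1 i + γ * ∑ j, lift (m.2 j) * lift (m'.2 j)

theorem gamma_mul_lift_residue {R : Type*} [CommRing R] [IsLocalRing R] {γ : R}
    (hR : IsChainRingOfIndexTwo R γ) (x : R) :
    γ * lift (IsLocalRing.residue R x) = γ * x := by
  have h1 : IsLocalRing.residue R (lift (IsLocalRing.residue R x)) = IsLocalRing.residue R x :=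
    Function.surjInv_eq IsLocalRing.residue_surjective _
  have h2 : lift (IsLocalRing.residue R x) - x ∈ IsLocalRing.maximalIdeal R :=
    Ideal.Quotient.eq.mp h1
  rw [hR.maximalIdeal_eq, Ideal.mem_span_singleton] at h2
  obtain ⟨c, hc⟩ := h2
  have h3 := hR.sq_eq_zero
  linear_combination γ * hc + c * h3

/-- The Euclidean dual code of a code (an `R`-submodule of `R₂ ^ N₁ ⊕ R₁ ^ N₂`), as a set. -/
def euclDual {R : Type*} [CommRing R] [IsLocalRing R] (γ : R) {N₁ N₂ : ℕ}
    (C : Submodule R (MixedSpace R N₁ N₂)) : Set (MixedSpace R N₁ N₂) :=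
  {m | ∀ m' ∈ C, euclForm γ m m' = 0}

/-- An `R₂R₁`-linear code is Euclidean self-dual if it equals its Euclidean dual code. -/
def IsEuclSelfDual {R : Type*} [CommRing R] [IsLocalRing R] (γ : R) {N₁ N₂ : ℕ}
    (C : Submodule R (MixedSpace R N₁ N₂)) : Prop :=
  (C : Set (MixedSpace R N₁ N₂)) = euclDual γ C

/-! ### Eisenstein extensions of Galois rings of characteristic `p ^ 2` and additive codes -/

/-- Reduction of `ZMod (p ^ 2)` modulo `p`. -/
def redHom (p : ℕ) : ZMod (p ^ 2) →+* ZMod p :=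
  ZMod.castHom (dvd_pow_self p two_ne_zero) (ZMod p)

/-- The data that define an Eisenstein extension with invariants `p, 2, r, k, t`: a monic basic
irreducible polynomial `h` of degree `r` over `ZMod (p ^ 2)`, which presents the Galois ring
`GR(p ^ 2, r)` as `AdjoinRoot h`, and the coefficients `c 0, …, c (k - 1)` in the Galois ring of
the Eisenstein polynomial `y ^ k + p (c (k - 1) y ^ (k - 1) + ⋯ + c 0)`, with `c 0` a unit. -/
structure EisensteinData (p r k t : ℕ) where
  h : (ZMod (p ^ 2))[X]
  monic_h : h.Monic
  natDegree_h : h.natDegree = r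
  irreducible_h : Irreducible (h.map (redHom p))
  one_le_t : 1 ≤ t
  t_le_k : t ≤ k
  c : ℕ → AdjoinRoot h
  isUnit_c_zero : IsUnit (c 0)

namespace EisensteinData

variable {p r k t : ℕ} (D : EisensteinData p r k t)

/-- The Galois ring `GR(p ^ 2, r)`. -/
abbrev GR : Type := AdjoinRoot D.h

/-- The Eisenstein polynomial. -/
def g : D.GR[X] := X ^ k + C (p : D.GR) * ∑ i ∈ Finset.range k, C (D.c i) * X ^ i

/-- The ideal `⟨g(y), p y ^ t⟩`. -/
def ideal : Ideal D.GR[X] := Ideal.span {D.g, C (p : D.GR) * X ^ t}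

/-- The finite commutative chain ring `GR(p ^ 2, r)[y] ⧸ ⟨g(y), p y ^ t⟩`. -/
abbrev Ring : Type := D.GR[X] ⧸ D.ideal

/-- The coordinate in `ZMod (p ^ 2)` of an element of the Galois ring at `x ^ s`, where `x` is the
root of `h` and `s < r`. -/
def grCoord (s : ℕ) : D.GR →+ ZMod (p ^ 2) :=
  (lcoeff (ZMod (p ^ 2)) s ∘ₗ AdjoinRoot.modByMonicHom D.monic_h).toAddMonoidHom

/-- The coefficient at `y ^ i` of the remainder of a polynomial on division by `g`. -/
def remCoeff (i : ℕ) : D.GR[X] →+ D.GR :=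
  (lcoeff D.GR i ∘ₗ modByMonicHom D.g).toAddMonoidHom

theorem degree_lt : (C (p : D.GR) * ∑ i ∈ Finset.range k, C (D.c i) * X ^ i).degree <
    (k : WithBot ℕ) := by
  have h1 : (∑ i ∈ Finset.range k, C (D.c i) * X ^ i).degree <
      (k : WithBot ℕ) := by
    rw [← mem_degreeLT]
    refine Submodule.sum_mem _ fun i hi => mem_degreeLT.mpr ?_
    exact lt_of_le_of_lt (degree_C_mul_X_pow_le i _) (by exact_mod_cast Finset.mem_range.mp hi)
  rw [← smul_eq_C_mul]
  exact lt_of_le_of_lt (degree_smul_le _ _) h1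

theorem monic_g : D.g.Monic := monic_X_pow_add D.degree_lt

theorem degree_g [Nontrivial D.GR] : D.g.degree = (k : WithBot ℕ) := by
  rw [g, degree_add_eq_left_of_degree_lt, degree_X_pow]
  rw [degree_X_pow]
  exact D.degree_lt

theorem p_mul_p : (p : D.GR) * p = 0 := by
  have h1 : ((p ^ 2 : ℕ) : ZMod (p ^ 2)) = 0 := ZMod.natCast_self _
  have h2 := congrArg (algebraMap (ZMod (p ^ 2)) D.GR) h1
  rw [map_natCast, map_zero] at h2
  rw [← h2]; push_cast; ring

/-- The remainder of an element of `⟨g(y), p y ^ t⟩` on division by `g` is `p d` for some `d`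
without terms in degrees below `t`. -/
theorem exists_remCoeff_eq {f : D.GR[X]} (hf : f ∈ D.ideal) :
    ∃ d : D.GR[X], (∀ i < t, d.coeff i = 0) ∧ ∀ i, D.remCoeff i f = p * d.coeff i := by
  rcases subsingleton_or_nontrivial D.GR with hs | hn
  · exact ⟨0, fun _ _ => Subsingleton.elim _ _, fun _ => Subsingleton.elim _ _⟩
  obtain ⟨a, b, hab⟩ := Ideal.mem_span_pair.mp hf
  have hk : (X ^ k : D.GR[X]).Monic := monic_X_pow k
  set v : D.GR[X] := b * X ^ t with hv
  set d : D.GR[X] := v %ₘ X ^ k with hd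
  have hdiv : d + X ^ k * (v /ₘ X ^ k) = v := modByMonic_add_div v (X ^ k)
  have hdeg : d.degree < (k : WithBot ℕ) := by
    have := degree_modByMonic_lt v hk
    rwa [degree_X_pow] at this
  have hp : C (p : D.GR) * D.g = C (p : D.GR) * X ^ k := by
    rw [g, mul_add, ← mul_assoc, ← C_mul, p_mul_p, C_0, zero_mul, add_zero]
  have hrem : f %ₘ D.g = C (p : D.GR) * d := by
    refine (div_modByMonic_unique (a + C (p : D.GR) * (v /ₘ X ^ k)) _ D.monic_g ⟨?_, ?_⟩).2
    · have e1 : a * D.g + C (p : D.GR) * v = f := by rw [← hab, hv]; ring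
      linear_combination e1 + C (p : D.GR) * hdiv + (v /ₘ X ^ k) * hp
    · rw [D.degree_g, ← smul_eq_C_mul]
      exact lt_of_le_of_lt (degree_smul_le _ _) hdeg
  refine ⟨d, fun i hi => ?_, fun i => ?_⟩
  · have e2 := congrArg (fun P => coeff P i) hdiv
    have hik : i < k := lt_of_lt_of_le hi D.t_le_k
    simp only [coeff_add, hv, coeff_X_pow_mul', coeff_mul_X_pow', not_le.mpr hi,
      not_le.mpr hik, if_false, add_zero] at e2
    exact e2
  · change (f %ₘ D.g).coeff i = _
    rw [hrem, coeff_C_mul]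

/-- The coordinate `a_{i,s}` in `ZMod (p ^ 2)` of `a = ∑ a_i y ^ i`, for `i < t`. -/
def coordX (i : Fin t) (s : Fin r) : D.Ring →+ ZMod (p ^ 2) :=
  QuotientAddGroup.lift D.ideal.toAddSubgroup ((D.grCoord s).comp (D.remCoeff i)) (by
    intro f hf
    obtain ⟨d, hd, hfd⟩ := D.exists_remCoeff_eq hf
    simp [hfd, hd i i.2])

/-- The coordinate `a_{t+j,s}` in `ZMod p` of `a = ∑ a_i y ^ i`, for `j < k - t`. -/
def coordY (j : Fin (k - t)) (s : Fin r) : D.Ring →+ ZMod p :=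
  QuotientAddGroup.lift D.ideal.toAddSubgroup
    ((redHom p).toAddMonoidHom.comp ((D.grCoord s).comp (D.remCoeff (t + j)))) (by
    intro f hf
    obtain ⟨d, -, hfd⟩ := D.exists_remCoeff_eq hf
    simp [hfd, ← nsmul_eq_mul, nsmul_eq_mul p (_ : ZMod p)])

/-- The value `χ_a(b)` of the character of the additive group attached to `a`, where `ξ` is a
primitive `p ^ 2`-th root of unity. -/
def chi (ξ : ℂ) (a b : D.Ring) : ℂ :=
  ∏ s : Fin r,
    ((∏ i : Fin t, ξ ^ (D.coordX i s a * D.coordX i s b).val) *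
      ∏ j : Fin (k - t), (ξ ^ p) ^ (D.coordY j s a * D.coordY j s b).val)

/-- The `χ`-dual of an additive code of length `N` (an additive subgroup), as a set. -/
def chiDual (ξ : ℂ) {N : ℕ} (C : AddSubgroup (Fin N → D.Ring)) : Set (Fin N → D.Ring) :=
  {d | ∀ c ∈ C, ∏ l, D.chi ξ (d l) (c l) = 1}

/-- An additive code is self-dual if it equals its `χ`-dual code. -/
def IsSelfDual (ξ : ℂ) {N : ℕ} (C : AddSubgroup (Fin N → D.Ring)) : Prop :=
  (C : Set (Fin N → D.Ring)) = D.chiDual ξ C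

end EisensteinData

end MixedCodes

end

namespace MixedCodes

open Matrix

/-! ### Counting by fibres -/

/-! Everything reduces to counting over the residue field K with q elements, q odd.

Self-orthogonal codes are counted through their ordered bases, the independent tuples of pairwise
orthogonal isotropic vectors. If v is isotropic and u is not orthogonal to v, the line u + Kv
contains exactly one isotropic vector; hence the number of ways to extend an isotropic tuple depends
only on its length and on the total number of isotropic vectors (`card_isotropic_perp`). That total
obeys a recursion from n to n + 2, obtained by counting sums of two squares with the quadratic
character (`card_isotropic_add_two`). Dividing by the number of bases gives `sigma_succ` and then
the closed formulas.

For mixed codes, all that matters is that R maps onto K with kernel a copy ι(K) of K, which makes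
the kernel square to zero (`IsMixedAlphabet`). A self-dual code C has a residue code, of dimension k
and self-orthogonal, and a torsion code U, self-dual over K. Once a basis of the residue code is
lifted to a tuple x in C, the code is recovered from x and U: it is generated by x and by all
residue-zero words orthogonal to x with second component in U. Conversely, every pairwise orthogonal
isotropic lift x and every self-dual U arise (`liftedBasisEquiv`). Counting the pairs (C, x) both
ways gives the number of codes with a given k. Since x may be empty, existence depends on U alone,
that is, on whether a self-dual code of length N₂ exists over K.

Additive codes over the Eisenstein extension are the case R = Z/p², K = Z/p: the coordinates
identify the ambient groups, and the product of characters is ξ raised to the value of the Euclidean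
form. -/

theorem card_eq_sum_card_fibers {α β : Type*} [Finite α] [Fintype β] (f : α → β) :
    Nat.card α = ∑ b, Nat.card {a // f a = b} := by
  rw [← Nat.card_sigma]
  exact Nat.card_congr (Equiv.sigmaFiberEquiv f).symm

/-- The fibre size is rational so that quotients of powers of q can be used in place of truncated
exponents. -/
theorem card_eq_mul_of_card_fibers {α β : Type*} [Finite α] [Finite β] (f : α → β) {c : ℚ}
    (h : ∀ b, (Nat.card {a // f a = b} : ℚ) = c) : (Nat.card α : ℚ) = Nat.card β * c := by
  have := Fintype.ofFinite β
  rw [card_eq_sum_card_fibers f, Nat.cast_sum, Finset.sum_congr rfl fun b _ => h b]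
  simp

/-- Counting tuples by extending them by one entry. -/
theorem card_snoc {α : Type*} [Finite α] {k : ℕ} {P : (Fin k → α) → Prop}
    {P' : (Fin (k + 1) → α) → Prop} {Q : (Fin k → α) → α → Prop}
    (h : ∀ x a, P' (Fin.snoc (α := fun _ => α) x a) ↔ P x ∧ Q x a) {c : ℚ}
    (hc : ∀ x, P x → (Nat.card {a // Q x a} : ℚ) = c) :
    (Nat.card {x // P' x} : ℚ) = Nat.card {x // P x} * c := by
  have h' : ∀ y : Fin (k + 1) → α, P' y ↔
      P (Fin.init (α := fun _ => α) y) ∧ Q (Fin.init (α := fun _ => α) y) (y (Fin.last k)) := by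
    intro y
    rw [← h, Fin.snoc_init_self]
  refine card_eq_mul_of_card_fibers
    (fun y : {x // P' x} => (⟨Fin.init (α := fun _ => α) y.1, ((h' _).1 y.2).1⟩ : {x // P x}))
    fun b => ?_
  rw [← hc b.1 b.2]
  congr 1
  refine Nat.card_congr
    ⟨fun y => ⟨y.1.1 (Fin.last k), ?_⟩,
      fun a => ⟨⟨Fin.snoc (α := fun _ => α) b.1 a.1, (h _ _).2 ⟨b.2, a.2⟩⟩, ?_⟩, ?_, ?_⟩
  · obtain ⟨⟨y, hy⟩, rfl⟩ := y
    exact ((h' _).1 hy).2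
  · simp
  · rintro ⟨⟨y, hy⟩, rfl⟩
    simp
  · rintro ⟨a, ha⟩
    simp

theorem card_linearMap_fiber {K V W : Type*} [Field K] [Finite K] [AddCommGroup V] [Module K V]
    [Finite V] [AddCommGroup W] [Module K W] (f : V →ₗ[K] W) (v₀ : V) :
    Nat.card {v // f v = f v₀} = Nat.card (LinearMap.ker f) :=
  Nat.card_congr
    ⟨fun v => ⟨v.1 - v₀, by simp [v.2]⟩, fun v => ⟨v.1 + v₀, by simp⟩,
      fun v => by simp, fun v => by simp⟩

section Field

variable {K : Type*} [Field K] {n k : ℕ}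

/-! ### Independent tuples and the standard form -/

/-- The matrix with rows `e i` has full row rank, so its linear map is onto. This is how
nondegeneracy of the standard form enters. -/
theorem exists_dotProduct_eq {e : Fin k → Fin n → K} (he : LinearIndependent K e)
    (s : Fin k → K) : ∃ a : Fin n → K, ∀ i, a ⬝ᵥ e i = s i := by
  have h1 : (Matrix.of e).rank = k := by
    simpa using LinearIndependent.rank_matrix (M := Matrix.of e) he
  have h2 : LinearMap.range (Matrix.of e).mulVecLin = ⊤ := by
    apply Submodule.eq_top_of_finrank_eq
    rw [← Matrix.rank, h1]; simp
  obtain ⟨a, ha⟩ := LinearMap.range_eq_top.1 h2 s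
  refine ⟨a, fun i => ?_⟩
  rw [← ha, dotProduct_comm]
  rfl

theorem le_of_linearIndependent {e : Fin k → Fin n → K} (he : LinearIndependent K e) : k ≤ n := by
  simpa using he.fintype_card_le_finrank

theorem card_dotProduct_eq [Finite K] {e : Fin k → Fin n → K} (he : LinearIndependent K e)
    (s : Fin k → K) :
    Nat.card {a : Fin n → K // ∀ i, a ⬝ᵥ e i = s i} = Nat.card K ^ (n - k) := by
  have h1 : (Matrix.of e).rank = k := by
    simpa using LinearIndependent.rank_matrix (M := Matrix.of e) he
  have key : ∀ a s, (∀ i, a ⬝ᵥ e i = s i) ↔ (Matrix.of e).mulVecLin a = s := by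
    intro a s
    rw [funext_iff]
    refine forall_congr' fun i => ?_
    rw [dotProduct_comm]
    rfl
  obtain ⟨a₀, h₀⟩ := exists_dotProduct_eq he s
  have h₁ := (key _ _).1 h₀
  simp_rw [key]
  subst h₁
  rw [card_linearMap_fiber, Module.natCard_eq_pow_finrank (K := K)]
  congr 1
  have := LinearMap.finrank_range_add_finrank_ker (Matrix.of e).mulVecLin
  rw [← Matrix.rank, h1] at this
  simp at this
  omega

/-- If c lay outside the span, the tuple extended by c would be independent, and some a would be
orthogonal to every `e i` while pairing to 1 with c. -/
theorem mem_span_of_perp {e : Fin k → Fin n → K} (he : LinearIndependent K e) {c : Fin n → K}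
    (hc : ∀ a : Fin n → K, (∀ i, a ⬝ᵥ e i = 0) → a ⬝ᵥ c = 0) :
    c ∈ Submodule.span K (Set.range e) := by
  by_contra h
  have h1 : LinearIndependent K (Fin.snoc (α := fun _ => Fin n → K) e c) :=
    linearIndependent_finSnoc.2 ⟨he, h⟩
  obtain ⟨a, ha⟩ := exists_dotProduct_eq h1 (Fin.snoc (α := fun _ => K) 0 1)
  have h2 := ha (Fin.last k)
  rw [Fin.snoc_last, Fin.snoc_last, hc a fun i => by simpa using ha i.castSucc] at h2
  exact zero_ne_one h2

theorem card_span [Finite K] {V : Type*} [AddCommGroup V] [Module K V] {e : Fin k → V}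
    (he : LinearIndependent K e) :
    Nat.card (Submodule.span K (Set.range e)) = Nat.card K ^ k := by
  have : Module.Finite K (Submodule.span K (Set.range e)) :=
    Module.Finite.span_of_finite K (Set.finite_range e)
  rw [Module.natCard_eq_pow_finrank (K := K), finrank_span_eq_card he, Fintype.card_fin]

/-! ### Isotropic tuples -/

/-- Linearly independent tuples of pairwise orthogonal isotropic vectors. -/
def IsIsotropicTuple (e : Fin k → Fin n → K) : Prop :=
  LinearIndependent K e ∧ ∀ i j, e i ⬝ᵥ e j = 0

theorem isIsotropicTuple_snoc (e : Fin k → Fin n → K) (v : Fin n → K) :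
    IsIsotropicTuple (Fin.snoc (α := fun _ => Fin n → K) e v) ↔
      IsIsotropicTuple e ∧
        (v ∉ Submodule.span K (Set.range e) ∧ (∀ i, v ⬝ᵥ e i = 0) ∧ v ⬝ᵥ v = 0) := by
  simp only [IsIsotropicTuple, linearIndependent_finSnoc, Fin.forall_fin_succ', Fin.snoc_castSucc,
    Fin.snoc_last, dotProduct_comm _ v, forall_and]
  tauto

theorem dotProduct_eq_zero_of_mem_span {e : Fin k → Fin n → K} {v w : Fin n → K}
    (hv : ∀ i, v ⬝ᵥ e i = 0) (hw : w ∈ Submodule.span K (Set.range e)) : v ⬝ᵥ w = 0 := by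
  induction hw using Submodule.span_induction with
  | mem x hx => obtain ⟨i, rfl⟩ := hx; exact hv i
  | zero => simp
  | add x y _ _ hx hy => rw [dotProduct_add, hx, hy, add_zero]
  | smul a x _ hx => rw [dotProduct_smul, hx, smul_zero]

/-- The number of isotropic vectors orthogonal to an isotropic tuple. -/
theorem card_isotropic_perp [Finite K] (h2 : (2 : K) ≠ 0) (e : Fin k → Fin n → K)
    (he : IsIsotropicTuple e) :
    Nat.card K * Nat.card {v : Fin n → K // (∀ i, v ⬝ᵥ e i = 0) ∧ v ⬝ᵥ v = 0} + Nat.card K ^ n =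
      Nat.card K * Nat.card {v : Fin n → K // v ⬝ᵥ v = 0} + Nat.card K ^ (n - k) := by
  classical
  induction k with
  | zero => simp
  | succ k ih =>
    obtain ⟨e, v, rfl⟩ : ∃ e' v, e = Fin.snoc (α := fun _ => Fin n → K) e' v :=
      ⟨_, _, (Fin.snoc_init_self e).symm⟩
    have hli := he.1
    rw [isIsotropicTuple_snoc] at he
    obtain ⟨he, hv, hve, hvv⟩ := he
    have ih := ih e he
    -- For u orthogonal to e, the square of u + t v is u·u + 2t (u·v), affine in t with nonzero
    -- slope. So each such line has a unique isotropic point, and translation by multiples of v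
    -- yields all vectors from the isotropic ones.
    let E : {u : Fin n → K // ((∀ i, u ⬝ᵥ e i = 0) ∧ u ⬝ᵥ u = 0) ∧ u ⬝ᵥ v ≠ 0} × K ≃
        {u : Fin n → K // (∀ i, u ⬝ᵥ e i = 0) ∧ u ⬝ᵥ v ≠ 0} :=
      { toFun := fun p => ⟨p.1.1 + p.2 • v, fun i => by
            simp [add_dotProduct, hve, p.1.2.1.1 i], by
            simpa [add_dotProduct, hvv] using p.1.2.2⟩
        invFun := fun u => ⟨⟨u.1 - ((u.1 ⬝ᵥ u.1) / (2 * (u.1 ⬝ᵥ v))) • v,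
            ⟨fun i => by simp [sub_dotProduct, hve, u.2.1 i], by
              have := u.2.2
              simp only [sub_dotProduct, dotProduct_sub, smul_dotProduct, dotProduct_smul, hvv,
                dotProduct_comm v u.1, smul_eq_mul]
              field_simp
              ring⟩,
            by simpa [sub_dotProduct, hvv] using u.2.2⟩, (u.1 ⬝ᵥ u.1) / (2 * (u.1 ⬝ᵥ v))⟩
        left_inv := by
          rintro ⟨⟨u, ⟨h1, h3⟩, h4⟩, t⟩
          have : (u + t • v) ⬝ᵥ (u + t • v) / (2 * ((u + t • v) ⬝ᵥ v)) = t := by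
            simp only [add_dotProduct, dotProduct_add, smul_dotProduct, dotProduct_smul, hvv,
                dotProduct_comm v u, smul_eq_mul, h3, mul_zero, add_zero, zero_add]
            rw [← two_mul, mul_left_comm, mul_div_assoc, div_self (mul_ne_zero h2 h4), mul_one]
          refine Prod.ext (Subtype.ext ?_) this
          change u + t • v - ((u + t • v) ⬝ᵥ (u + t • v) / (2 * ((u + t • v) ⬝ᵥ v))) • v = u
          rw [this, add_sub_cancel_right]
        right_inv := by
          rintro ⟨u, h1, h3⟩
          simp }
    have hE := Nat.card_congr E
    rw [Nat.card_prod] at hE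
    have split : ∀ P Q : (Fin n → K) → Prop, Nat.card {u // P u} =
        Nat.card {u // P u ∧ Q u} + Nat.card {u // P u ∧ ¬ Q u} := by
      intro P Q
      rw [← Nat.card_sum]
      refine Nat.card_congr ((Equiv.sumCompl fun u : {u // P u} => Q u.1).symm.trans ?_)
      exact Equiv.sumCongr (Equiv.subtypeSubtypeEquivSubtypeInter P Q)
        (Equiv.subtypeSubtypeEquivSubtypeInter P fun u => ¬ Q u)
    have s1 := split (fun u => (∀ i, u ⬝ᵥ e i = 0) ∧ u ⬝ᵥ u = 0) (fun u => u ⬝ᵥ v = 0)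
    have s2 := split (fun u => (∀ i, u ⬝ᵥ e i = 0)) (fun u => u ⬝ᵥ v = 0)
    have c1 : Nat.card {u : Fin n → K // (∀ i, u ⬝ᵥ e i = 0)} = Nat.card K ^ (n - k) :=
      card_dotProduct_eq he.1 0
    have c2 : Nat.card {u : Fin n → K // (∀ i, u ⬝ᵥ e i = 0) ∧ u ⬝ᵥ v = 0} =
        Nat.card K ^ (n - (k + 1)) := by
      rw [← card_dotProduct_eq hli 0]
      simp [Fin.forall_fin_succ']
    have c3 : Nat.card {u : Fin n → K // ((∀ i, u ⬝ᵥ e i = 0) ∧ u ⬝ᵥ u = 0) ∧ u ⬝ᵥ v = 0} =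
        Nat.card {u : Fin n → K // (∀ i : Fin (k + 1),
          u ⬝ᵥ Fin.snoc (α := fun _ => Fin n → K) e v i = 0) ∧ u ⬝ᵥ u = 0} := by
      refine Nat.card_congr (Equiv.subtypeEquivRight fun u => ?_)
      simp only [Fin.forall_fin_succ', Fin.snoc_castSucc, Fin.snoc_last]
      tauto
    simp only [ne_eq] at hE
    rw [c1, c2, ← hE] at s2
    rw [c3] at s1
    rw [s1, s2] at ih
    linarith

/-- The number of ways to extend an isotropic tuple by one vector. -/
theorem card_isotropic_extension [Finite K] (h2 : (2 : K) ≠ 0) (e : Fin k → Fin n → K)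
    (he : IsIsotropicTuple e) :
    (Nat.card {v : Fin n → K // v ∉ Submodule.span K (Set.range e) ∧ (∀ i, v ⬝ᵥ e i = 0) ∧
        v ⬝ᵥ v = 0} : ℚ) =
      Nat.card {v : Fin n → K // v ⬝ᵥ v = 0} +
        ((Nat.card K : ℚ) ^ n / Nat.card K ^ k - Nat.card K ^ n) / Nat.card K - Nat.card K ^ k := by
  classical
  have h1 := card_isotropic_perp h2 e he
  have hk := le_of_linearIndependent he.1
  have hq : (Nat.card K : ℚ) ≠ 0 := by exact_mod_cast Nat.card_pos.ne'
  -- The span of e is totally isotropic, so all of its q ^ k vectors are among those counted and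
  -- have to be removed.
  have h3 : Nat.card {v : Fin n → K // (∀ i, v ⬝ᵥ e i = 0) ∧ v ⬝ᵥ v = 0} =
      Nat.card K ^ k + Nat.card {v : Fin n → K // v ∉ Submodule.span K (Set.range e) ∧
        (∀ i, v ⬝ᵥ e i = 0) ∧ v ⬝ᵥ v = 0} := by
    rw [← card_span he.1, ← Nat.card_sum]
    refine Nat.card_congr ((Equiv.sumCompl fun u : {v : Fin n → K // (∀ i, v ⬝ᵥ e i = 0) ∧
      v ⬝ᵥ v = 0} => u.1 ∈ Submodule.span K (Set.range e)).symm.trans (Equiv.sumCongr ?_ ?_))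
    · refine (Equiv.subtypeSubtypeEquivSubtypeInter _ _).trans (Equiv.subtypeEquivRight ?_)
      intro v
      refine ⟨fun h => h.2, fun h => ⟨?_, h⟩⟩
      have : ∀ i, v ⬝ᵥ e i = 0 := fun i => by
        rw [dotProduct_comm]
        exact dotProduct_eq_zero_of_mem_span (he.2 i) h
      exact ⟨this, dotProduct_eq_zero_of_mem_span this h⟩
    · refine (Equiv.subtypeSubtypeEquivSubtypeInter _
        (fun v => v ∉ Submodule.span K (Set.range e))).trans (Equiv.subtypeEquivRight ?_)
      intro v
      tauto
  have h1' := congrArg (Nat.cast : ℕ → ℚ) h1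
  rw [h3] at h1'
  push_cast [pow_sub₀ _ hq hk] at h1'
  field_simp at h1' ⊢
  linarith

theorem card_isotropicTuple_succ [Finite K] (h2 : (2 : K) ≠ 0) (n k : ℕ) :
    (Nat.card {e : Fin (k + 1) → Fin n → K // IsIsotropicTuple e} : ℚ) =
      Nat.card {e : Fin k → Fin n → K // IsIsotropicTuple e} *
      (Nat.card {v : Fin n → K // v ⬝ᵥ v = 0} +
        ((Nat.card K : ℚ) ^ n / Nat.card K ^ k - Nat.card K ^ n) / Nat.card K
          - Nat.card K ^ k) :=
  card_snoc isIsotropicTuple_snoc fun e he => card_isotropic_extension h2 e he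

/-- An independent k-tuple inside a k-dimensional space spans it, so the count is the order of GL_k
over K. -/
theorem card_bases_of_finrank [Finite K] {V : Type*} [AddCommGroup V] [Module K V] [Finite V]
    (C : Submodule K V) (hC : Module.finrank K C = k) :
    Nat.card {e : Fin k → V // LinearIndependent K e ∧ Submodule.span K (Set.range e) = C} =
      ∏ i : Fin k, (Nat.card K ^ k - Nat.card K ^ (i : ℕ)) := by
  have := Fintype.ofFinite K
  have h := card_linearIndependent (K := K) (V := C) (k := k) hC.ge
  rw [hC, ← Nat.card_eq_fintype_card] at h
  rw [← h]
  refine Nat.card_congr ⟨fun e => ⟨fun i => ⟨e.1 i, ?_⟩, ?_⟩,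
    fun e => ⟨fun i => e.1 i, ?_, ?_⟩, fun e => rfl, fun e => rfl⟩
  · exact e.2.2.le (Submodule.subset_span ⟨i, rfl⟩)
  · exact LinearIndependent.of_comp C.subtype e.2.1
  · exact e.2.map' C.subtype C.ker_subtype
  · have h1 := e.2.span_eq_top_of_card_eq_finrank' (by simp [hC])
    have h2 := congrArg (Submodule.map C.subtype) h1
    rw [Submodule.map_span, Submodule.map_top, Submodule.range_subtype, ← Set.range_comp] at h2
    exact h2

theorem isSelfOrthogonal_span {e : Fin k → Fin n → K} (he : IsIsotropicTuple e) :
    IsSelfOrthogonal (Submodule.span K (Set.range e)) := by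
  intro v hv w hw
  refine dotProduct_eq_zero_of_mem_span (fun i => ?_) hw
  rw [dotProduct_comm]
  exact dotProduct_eq_zero_of_mem_span (he.2 i) hv

/-- The fibres of e ↦ span e are sets of bases, because every basis of a self-orthogonal code is an
isotropic tuple. -/
theorem card_isotropicTuple [Finite K] (n k : ℕ) :
    Nat.card {e : Fin k → Fin n → K // IsIsotropicTuple e} =
      sigma K n k * ∏ i : Fin k, (Nat.card K ^ k - Nat.card K ^ (i : ℕ)) := by
  have h := card_eq_mul_of_card_fibers
    (fun e : {e : Fin k → Fin n → K // IsIsotropicTuple e} =>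
      (⟨Submodule.span K (Set.range e.1), by rw [finrank_span_eq_card e.2.1, Fintype.card_fin],
        isSelfOrthogonal_span e.2⟩ :
        {C : Submodule K (Fin n → K) // Module.finrank K C = k ∧ IsSelfOrthogonal C}))
    (c := (∏ i : Fin k, (Nat.card K ^ k - Nat.card K ^ (i : ℕ)) : ℕ)) fun C => by
      rw [← card_bases_of_finrank C.1 C.2.1]
      congr 1
      refine Nat.card_congr ((Equiv.subtypeEquivRight fun e => ?_).trans
        (Equiv.subtypeSubtypeEquivSubtype
          (q := fun e => LinearIndependent K e ∧ Submodule.span K (Set.range e) = C.1) ?_))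
      · rw [Subtype.ext_iff]
        exact ⟨fun h => ⟨e.2.1, h⟩, fun h => h.2⟩
      · rintro e ⟨h1, h2⟩
        refine ⟨h1, fun i j => C.2.2 _ ?_ _ ?_⟩ <;>
        · rw [← h2]
          exact Submodule.subset_span ⟨_, rfl⟩
  exact_mod_cast h

end Field

section Sigma

variable {K : Type*} [Field K]

theorem two_ne_zero_of_odd_card [Finite K] (hK : Odd (Nat.card K)) : (2 : K) ≠ 0 := by
  have := Fintype.ofFinite K
  rw [Nat.card_eq_fintype_card] at hK
  refine Ring.two_ne_zero fun h => ?_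
  have h1 := FiniteField.even_card_iff_char_two.1 h
  rw [Nat.odd_iff] at hK
  omega

theorem ringChar_ne_two_of_odd_card [Finite K] (hK : Odd (Nat.card K)) :
    ringChar K ≠ 2 := fun h =>
  two_ne_zero_of_odd_card hK (by
    have := ringChar.Nat.cast_ringChar (R := K)
    rw [h] at this
    exact_mod_cast this)

/-! ### Isotropic vectors -/

/-- For d = 0 each nonzero a contributes χ(-1). For d ≠ 0 the substitution a = d b turns the sum
into the Jacobi sum of χ with itself, where χ is its own inverse, and this equals -χ(-1). -/
theorem sum_quadraticChar_mul [Fintype K] [DecidableEq K] (hK : ringChar K ≠ 2) (d : K) :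
    ∑ a, quadraticChar K a * quadraticChar K (d - a) =
      (if d = 0 then (Fintype.card K : ℤ) * quadraticChar K (-1) else 0) -
        quadraticChar K (-1) := by
  split_ifs with h
  · subst h
    have h1 : ∀ a : K, quadraticChar K a * quadraticChar K (0 - a) =
        quadraticChar K (-1) * if a = 0 then 0 else 1 := by
      intro a
      split_ifs with ha
      · simp [ha]
      · rw [zero_sub, neg_eq_neg_one_mul, map_mul, mul_left_comm, ← sq, quadraticChar_sq_one ha]
    rw [Finset.sum_congr rfl fun a _ => h1 a, ← Finset.mul_sum]
    have h2 : ∑ a : K, (if a = 0 then (0 : ℤ) else 1) = Fintype.card K - 1 := by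
      have : ∀ a : K, (if a = 0 then (0 : ℤ) else 1) = 1 - if a = 0 then 1 else 0 := by
        intro a; split_ifs <;> simp
      rw [Finset.sum_congr rfl fun a _ => this a, Finset.sum_sub_distrib]
      simp
    rw [h2]
    ring
  · have h1 := jacobiSum_nontrivial_inv (quadraticChar_ne_one hK)
    rw [(quadraticChar_isQuadratic K).inv, jacobiSum] at h1
    rw [← Equiv.sum_comp (Equiv.mulLeft₀ d h), zero_sub, ← h1]
    refine Finset.sum_congr rfl fun b _ => ?_
    rw [Equiv.mulLeft₀_apply, show d - d * b = d * (1 - b) by ring, map_mul, map_mul]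
    linear_combination
      quadraticChar K b * quadraticChar K (1 - b) * quadraticChar_sq_one (F := K) h

/-- The number of representations as a sum of two squares. -/
theorem card_sum_two_squares [Fintype K] [DecidableEq K] (hK : ringChar K ≠ 2) (d : K) :
    (Nat.card {p : K × K // p.1 * p.1 + p.2 * p.2 = d} : ℤ) =
      Fintype.card K - quadraticChar K (-1) +
        if d = 0 then (Fintype.card K : ℤ) * quadraticChar K (-1) else 0 := by
  -- The count is the sum over a of (χ(a) + 1)(χ(d - a) + 1). On expansion the two linear character
  -- sums vanish, and the product term is `sum_quadraticChar_mul`.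
  have hsq : ∀ a : K, (Nat.card {x : K // x * x = a} : ℤ) = quadraticChar K a + 1 := by
    intro a
    rw [← quadraticChar_card_sqrts hK a, Set.toFinset_card, ← Nat.card_eq_fintype_card]
    simp only [Set.coe_ofPred, sq]
  have hfib : ∀ a, (Nat.card {p : {p : K × K // p.1 * p.1 + p.2 * p.2 = d} //
      p.1.1 * p.1.1 = a} : ℤ) = (quadraticChar K a + 1) * (quadraticChar K (d - a) + 1) := by
    intro a
    rw [← hsq, ← hsq, ← Nat.cast_mul, ← Nat.card_prod]
    congr 1
    refine Nat.card_congr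
      ⟨fun p => (⟨p.1.1.1, p.2⟩, ⟨p.1.1.2, ?_⟩), fun p => ⟨⟨(p.1.1, p.2.1), ?_⟩, p.1.2⟩, ?_, ?_⟩
    · have h1 := p.2
      have h2 := p.1.2
      linear_combination h2 - h1
    · change p.1.1 * p.1.1 + p.2.1 * p.2.1 = d
      rw [p.1.2, p.2.2]
      ring
    · intro p; rfl
    · intro p; rfl
  rw [card_eq_sum_card_fibers fun p : {p : K × K // p.1 * p.1 + p.2 * p.2 = d} => p.1.1 * p.1.1]
  rw [Nat.cast_sum, Finset.sum_congr rfl fun a _ => hfib a]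
  have h0 : ∑ a : K, quadraticChar K (d - a) = 0 := by
    rw [← quadraticChar_sum_zero hK]
    exact Equiv.sum_comp (Equiv.subLeft d) _
  simp only [add_mul, mul_add, Finset.sum_add_distrib, mul_one, one_mul,
    sum_quadraticChar_mul hK, h0, quadraticChar_sum_zero hK]
  simp
  ring

/-- Over a tail w the first two entries represent -(w·w) as a sum of two squares; the extra term q
χ(-1) appears exactly when w is itself isotropic. -/
theorem card_isotropic_add_two [Fintype K] [DecidableEq K] (hK : ringChar K ≠ 2) (n : ℕ) :
    (Nat.card {v : Fin (n + 2) → K // v ⬝ᵥ v = 0} : ℤ) =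
      (Fintype.card K - quadraticChar K (-1)) * Fintype.card K ^ n +
        Fintype.card K * quadraticChar K (-1) * Nat.card {v : Fin n → K // v ⬝ᵥ v = 0} := by
  have hfib : ∀ w : Fin n → K, (Nat.card {v : {v : Fin (n + 2) → K // v ⬝ᵥ v = 0} //
      vecTail (vecTail v.1) = w} : ℤ) = Fintype.card K - quadraticChar K (-1) +
        if w ⬝ᵥ w = 0 then (Fintype.card K : ℤ) * quadraticChar K (-1) else 0 := by
    intro w
    have h1 := card_sum_two_squares hK (-(w ⬝ᵥ w))
    simp only [neg_eq_zero] at h1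
    rw [← h1]
    congr 1
    refine Nat.card_congr ⟨fun v => ⟨(v.1.1 0, v.1.1 1), ?_⟩,
      fun p => ⟨⟨vecCons p.1.1 (vecCons p.1.2 w), ?_⟩, ?_⟩, ?_, ?_⟩
    · obtain ⟨⟨v, hv⟩, rfl⟩ := v
      simp only [dotProduct, Fin.sum_univ_succ] at hv
      change v 0 * v 0 + v 1 * v 1 = -∑ i : Fin n, v i.succ.succ * v i.succ.succ
      rw [← add_assoc] at hv
      exact eq_neg_of_add_eq_zero_left hv
    · have := p.2
      rw [cons_dotProduct_cons, cons_dotProduct_cons, ← add_assoc, this, neg_add_cancel]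
    · simp
    · rintro ⟨⟨v, hv⟩, rfl⟩
      apply Subtype.ext
      apply Subtype.ext
      funext i
      refine Fin.cases rfl (fun i => ?_) i
      exact Fin.cases rfl (fun i => rfl) i
    · intro p; rfl
  rw [card_eq_sum_card_fibers fun v : {v : Fin (n + 2) → K // v ⬝ᵥ v = 0} =>
    vecTail (vecTail v.1), Nat.cast_sum, Finset.sum_congr rfl fun w _ => hfib w,
    Finset.sum_add_distrib, ← Finset.sum_filter, Finset.sum_const, Finset.sum_const,
    Nat.card_eq_fintype_card, Fintype.card_subtype]
  simp
  ring

/-- In this form ν is multiplied by χ(-1) when n grows by 2, as the recursion for isotropic vectors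
requires. -/
theorem nu_eq_quadraticChar_pow [Fintype K] [DecidableEq K] (n : ℕ) :
    nu K n = (quadraticChar K (-1) : ℚ) ^ (n / 2) := by
  have h0 : (-1 : K) ^ (n / 2) ≠ 0 := pow_ne_zero _ (neg_ne_zero.2 one_ne_zero)
  rw [nu, ← Int.cast_pow, ← map_pow]
  split_ifs with h
  · rw [(quadraticChar_one_iff_isSquare h0).2 h, Int.cast_one]
  · rw [quadraticChar_neg_one_iff_not_isSquare.2 h, Int.cast_neg, Int.cast_one]

theorem nu_sq (n : ℕ) : nu K n ^ 2 = 1 := by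
  rw [nu]
  split_ifs <;> norm_num

theorem card_isotropic_odd [Finite K] (hK : Odd (Nat.card K)) (m : ℕ) :
    (Nat.card {v : Fin (2 * m + 1) → K // v ⬝ᵥ v = 0} : ℚ) = (Nat.card K : ℚ) ^ (2 * m) := by
  classical
  have := Fintype.ofFinite K
  induction m with
  | zero =>
    have : Unique {v : Fin (2 * 0 + 1) → K // v ⬝ᵥ v = 0} :=
      ⟨⟨⟨0, by simp⟩⟩, fun v => Subtype.ext <| funext fun i => by
        have := v.2
        simp only [Nat.mul_zero, dotProduct, Fin.sum_univ_succ, Finset.univ_eq_empty,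
          Finset.sum_empty, add_zero, mul_self_eq_zero] at this
        rw [show i = 0 from Fin.ext (by omega), this]
        rfl⟩
    simp
  | succ m ih =>
    have h := card_isotropic_add_two (ringChar_ne_two_of_odd_card hK) (2 * m + 1)
    have h' := congrArg (Int.cast : ℤ → ℚ) h
    push_cast at h'
    rw [← Nat.card_eq_fintype_card, ih] at h'
    rw [show 2 * (m + 1) + 1 = 2 * m + 1 + 2 by ring, h']
    ring

/-- The identity is multiplied by q so that no exponent m - 1 occurs and m = 0 can start the
induction. -/
theorem card_isotropic_even [Finite K] (hK : Odd (Nat.card K)) (m : ℕ) :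
    (Nat.card {v : Fin (2 * m) → K // v ⬝ᵥ v = 0} : ℚ) * Nat.card K =
      (Nat.card K : ℚ) ^ (2 * m) +
        nu K (2 * m) * ((Nat.card K : ℚ) ^ (m + 1) - (Nat.card K : ℚ) ^ m) := by
  classical
  have := Fintype.ofFinite K
  induction m with
  | zero => simp [nu_eq_quadraticChar_pow]
  | succ m ih =>
    have h := card_isotropic_add_two (ringChar_ne_two_of_odd_card hK) (2 * m)
    have h' := congrArg (Int.cast : ℤ → ℚ) h
    push_cast at h'
    rw [← Nat.card_eq_fintype_card] at h'
    rw [nu_eq_quadraticChar_pow, Nat.mul_div_cancel_left _ two_pos] at ih ⊢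
    rw [show 2 * (m + 1) = 2 * m + 2 by ring, h']
    linear_combination (Nat.card K : ℚ) * quadraticChar K (-1) * ih

/-! ### The formula for the number of self-orthogonal codes -/

theorem one_lt_card [Finite K] : (1 : ℚ) < Nat.card K := by
  exact_mod_cast Finite.one_lt_card

/-- The factor i = 0 is split off, and one q is taken out of each of the other k factors. -/
theorem prod_card_pow_sub_succ [Finite K] (k : ℕ) :
    ((∏ i : Fin (k + 1), (Nat.card K ^ (k + 1) - Nat.card K ^ (i : ℕ)) : ℕ) : ℚ) =
      ((Nat.card K : ℚ) ^ (k + 1) - 1) * Nat.card K ^ k *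
        (∏ i : Fin k, (Nat.card K ^ k - Nat.card K ^ (i : ℕ)) : ℕ) := by
  have hq : 0 < Nat.card K := Nat.card_pos
  have h : ∀ (m : ℕ) (i : Fin m), ((Nat.card K ^ m - Nat.card K ^ (i : ℕ) : ℕ) : ℚ) =
      (Nat.card K : ℚ) ^ m - Nat.card K ^ (i : ℕ) := fun m i => by
    rw [Nat.cast_sub (Nat.pow_le_pow_right hq i.2.le)]
    push_cast
    rfl
  rw [Nat.cast_prod, Nat.cast_prod, Finset.prod_congr rfl fun i _ => h _ i,
    Finset.prod_congr rfl fun i _ => h _ i, Fin.prod_univ_succ, mul_assoc, Fin.val_zero, pow_zero]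
  congr 1
  · rw [show (Nat.card K : ℚ) ^ k = ∏ i : Fin k, (Nat.card K : ℚ) by simp,
      ← Finset.prod_mul_distrib]
    refine Finset.prod_congr rfl fun i _ => ?_
    rw [Finset.prod_const, Finset.card_univ, Fintype.card_fin, Fin.val_succ]
    ring

theorem prod_card_pow_sub_pos [Finite K] (k : ℕ) :
    0 < ∏ i : Fin k, (Nat.card K ^ k - Nat.card K ^ (i : ℕ)) :=
  Finset.prod_pos fun i _ => Nat.sub_pos_of_lt (Nat.pow_lt_pow_right Finite.one_lt_card i.2)

/-- The extension count for isotropic tuples is divided by the growth of the number of bases from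
dimension k to k + 1. -/
theorem sigma_succ [Finite K] (hK : Odd (Nat.card K)) (n k : ℕ) :
    (sigma K n (k + 1) : ℚ) * ((Nat.card K : ℚ) ^ (k + 1) - 1) * Nat.card K ^ k =
      sigma K n k * (Nat.card {v : Fin n → K // v ⬝ᵥ v = 0} +
        ((Nat.card K : ℚ) ^ n / Nat.card K ^ k - Nat.card K ^ n) / Nat.card K
          - Nat.card K ^ k) := by
  have h := card_isotropicTuple_succ (two_ne_zero_of_odd_card hK) n k
  rw [card_isotropicTuple, card_isotropicTuple, Nat.cast_mul, Nat.cast_mul,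
    prod_card_pow_sub_succ] at h
  have h0 : ((∏ i : Fin k, (Nat.card K ^ k - Nat.card K ^ (i : ℕ)) : ℕ) : ℚ) ≠ 0 := by
    exact_mod_cast (prod_card_pow_sub_pos k).ne'
  apply mul_right_cancel₀ h0
  linear_combination h

theorem sigma_zero [Finite K] (n : ℕ) : sigma K n 0 = 1 := by
  have h := card_isotropicTuple (K := K) n 0
  have : Unique {e : Fin 0 → Fin n → K // IsIsotropicTuple e} :=
    ⟨⟨⟨Fin.elim0, linearIndependent_empty_type, fun i => i.elim0⟩⟩, fun v =>
      Subtype.ext (Subsingleton.elim _ _)⟩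
  simpa [Nat.card_unique] using h.symm

theorem sigma_odd_mul [Finite K] (hK : Odd (Nat.card K)) (m s : ℕ) (hs : s ≤ m) :
    (sigma K (2 * m + 1) s : ℚ) * ∏ j ∈ Finset.Icc 1 s, ((Nat.card K : ℚ) ^ j - 1) =
      ∏ i ∈ Finset.range s, ((Nat.card K : ℚ) ^ (2 * m + 1 - 1 - 2 * i) - 1) := by
  have hq : (Nat.card K : ℚ) ≠ 0 := by exact_mod_cast Nat.card_pos.ne'
  induction s with
  | zero => simp [sigma_zero]
  | succ s ih =>
    have ih := ih (by omega)
    obtain ⟨r, rfl⟩ : ∃ r, m = s + 1 + r := Nat.exists_eq_add_of_le hs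
    have h := sigma_succ hK (2 * (s + 1 + r) + 1) s
    rw [card_isotropic_odd hK] at h
    rw [Finset.prod_Icc_succ_top (by omega), Finset.prod_range_succ, ← ih,
      show 2 * (s + 1 + r) + 1 - 1 - 2 * s = 2 * r + 2 by omega]
    apply mul_right_cancel₀ (pow_ne_zero s hq)
    -- In odd length n = 2m + 1 the isotropic count q ^ (2m) cancels, leaving q ^ s (q ^ (2m - 2s) -
    -- 1).
    have h3 : (Nat.card K : ℚ) ^ (2 * (s + 1 + r)) +
        ((Nat.card K : ℚ) ^ (2 * (s + 1 + r) + 1) / Nat.card K ^ s -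
          Nat.card K ^ (2 * (s + 1 + r) + 1)) / Nat.card K - Nat.card K ^ s =
        ((Nat.card K : ℚ) ^ (2 * r + 2) - 1) * Nat.card K ^ s := by
      field_simp
      ring
    rw [h3] at h
    linear_combination (∏ j ∈ Finset.Icc 1 s, ((Nat.card K : ℚ) ^ j - 1)) * h

/-- The extension factor is q ^ s (q ^ (m - s) - ν)(q ^ (m - s - 1) + ν). Since ν² = 1, the plus
factor of one step and the minus factor of the next combine to q ^ (2m - 2s) - 1, so only the first
minus factor and the last plus factor remain. -/
theorem sigma_even_mul [Finite K] (hK : Odd (Nat.card K)) (m s : ℕ) (h1 : 1 ≤ s) (hs : s ≤ m) :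
    (sigma K (2 * m) s : ℚ) * ∏ j ∈ Finset.Icc 1 s, ((Nat.card K : ℚ) ^ j - 1) =
      ((Nat.card K : ℚ) ^ m - nu K (2 * m)) * ((Nat.card K : ℚ) ^ (m - s) + nu K (2 * m)) *
        ∏ i ∈ Finset.Icc 1 (s - 1), ((Nat.card K : ℚ) ^ (2 * m - 2 * i) - 1) := by
  have hq : (Nat.card K : ℚ) ≠ 0 := by exact_mod_cast Nat.card_pos.ne'
  have hnu := nu_sq (K := K) (2 * m)
  have hE : ∀ s r, m = s + 1 + r → (Nat.card {v : Fin (2 * m) → K // v ⬝ᵥ v = 0} : ℚ) +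
        ((Nat.card K : ℚ) ^ (2 * m) / Nat.card K ^ s - Nat.card K ^ (2 * m)) / Nat.card K
          - Nat.card K ^ s = Nat.card K ^ s *
        (((Nat.card K : ℚ) ^ (m - s) - nu K (2 * m)) *
          ((Nat.card K : ℚ) ^ (m - (s + 1)) + nu K (2 * m))) := by
    intro s r hm
    apply mul_right_cancel₀ hq
    have h3 := card_isotropic_even hK m
    rw [sub_mul, add_mul, h3, div_mul_cancel₀ _ hq, show m - s = r + 1 by omega,
      show m - (s + 1) = r by omega]
    generalize nu K (2 * m) = ν at hnu ⊢
    subst hm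
    field_simp
    linear_combination ((Nat.card K : ℚ) ^ (2 * s + 1)) * hnu
  induction s, h1 using Nat.le_induction with
  | base =>
    have h := sigma_succ hK (2 * m) 0
    rw [hE 0 (m - 1) (by omega), sigma_zero] at h
    simpa using h
  | succ s h1 ih =>
    have ih := ih (by omega)
    have h := sigma_succ hK (2 * m) s
    rw [hE s (m - (s + 1)) (by omega)] at h
    have e1 : s + 1 - 1 = s - 1 + 1 := by omega
    rw [Finset.prod_Icc_succ_top (by omega), e1, Finset.prod_Icc_succ_top (by omega),
      show s - 1 + 1 = s by omega, show 2 * m - 2 * s = (m - s) + (m - s) by omega]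
    apply mul_right_cancel₀ (pow_ne_zero s hq)
    rw [pow_add (Nat.card K : ℚ) (m - s) (m - s)]
    generalize (∏ j ∈ Finset.Icc 1 s, ((Nat.card K : ℚ) ^ j - 1)) = A at *
    generalize (∏ i ∈ Finset.Icc 1 (s - 1), ((Nat.card K : ℚ) ^ (2 * m - 2 * i) - 1)) = B at *
    generalize nu K (2 * m) = ν at *
    linear_combination A * h + (Nat.card K : ℚ) ^ s * ((Nat.card K : ℚ) ^ (m - s) - ν) *
          ((Nat.card K : ℚ) ^ (m - (s + 1)) + ν) * ih -
        ((Nat.card K : ℚ) ^ m - ν) * ((Nat.card K : ℚ) ^ (m - (s + 1)) + ν) * B *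
          (Nat.card K : ℚ) ^ s * hnu

theorem prod_Icc_pow_sub_one_ne_zero [Finite K] (s : ℕ) :
    ∏ j ∈ Finset.Icc 1 s, ((Nat.card K : ℚ) ^ j - 1) ≠ 0 := by
  refine Finset.prod_ne_zero_iff.2 fun j hj => ?_
  have := one_lt_pow₀ (one_lt_card (K := K)) (n := j) (by have := Finset.mem_Icc.1 hj; omega)
  linarith

/-- A self-orthogonal code has dimension at most half of its length. -/
theorem IsSelfOrthogonal.two_mul_finrank_le [Finite K] {n : ℕ} {C : Submodule K (Fin n → K)}
    (hC : IsSelfOrthogonal C) : 2 * Module.finrank K C ≤ n := by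
  let b := Module.finBasis K C
  have hb : LinearIndependent K fun i => (b i : Fin n → K) :=
    b.linearIndependent.map' C.subtype C.ker_subtype
  have h1 := card_dotProduct_eq hb 0
  -- C lies in its own dual, which has q ^ (n - dim C) elements.
  have h2 : Nat.card C ≤
      Nat.card {a : Fin n → K // ∀ i, a ⬝ᵥ (b i : Fin n → K) = (0 : Fin (Module.finrank K C) → K) i} :=
    Nat.card_le_card_of_injective
      (fun c => ⟨c.1, fun i => hC _ c.2 _ (b i).2⟩) fun c c' h =>
        Subtype.ext (Subtype.mk.inj h)
  rw [h1, Module.natCard_eq_pow_finrank (K := K)] at h2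
  have h3 := (Nat.pow_le_pow_iff_right Finite.one_lt_card).1 h2
  have h4 := le_of_linearIndependent hb
  omega

theorem sigma_eq_zero [Finite K] {n s : ℕ} (h : n < 2 * s) : sigma K n s = 0 := by
  have : IsEmpty {C : Submodule K (Fin n → K) // Module.finrank K C = s ∧ IsSelfOrthogonal C} :=
    ⟨fun C => by have := C.2.2.two_mul_finrank_le; rw [C.2.1] at this; omega⟩
  exact Nat.card_of_isEmpty

theorem sigma_eq_sigmaFormula [Finite K] (hK : Odd (Nat.card K)) (n s : ℕ) :
    (sigma K n s : ℚ) = sigmaFormula K n s := by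
  rw [sigmaFormula]
  split_ifs with h0 h1 h2
  · rw [h0, sigma_zero, Nat.cast_one]
  · rw [sigma_eq_zero h1, Nat.cast_zero]
  · obtain ⟨m, rfl⟩ := h2
    rw [eq_div_iff (prod_Icc_pow_sub_one_ne_zero s)]
    exact sigma_odd_mul hK m s (by omega)
  · obtain ⟨m, rfl⟩ := even_iff_two_dvd.1 (Nat.not_odd_iff_even.1 h2)
    rw [eq_div_iff (prod_Icc_pow_sub_one_ne_zero s), sigma_even_mul hK m s (by omega) (by omega)]
    congr 1
    obtain ⟨r, rfl⟩ : ∃ r, m = s + r := Nat.exists_eq_add_of_le (by omega)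
    rw [Nat.mul_div_cancel_left _ two_pos, show 2 * (s + r) - s = s + r + r by omega,
      show s + r - s = r by omega, pow_add]
    -- The stated factor is (q ^ m - ν)(q ^ (m - s) + ν) multiplied out, with ν² = 1.
    linear_combination -nu_sq (K := K) (2 * (s + r))

/-- At s = m the last plus factor is 1 + ν, which vanishes exactly for ν = -1; the other factors are
nonzero. -/
theorem sigma_half_pos_iff [Finite K] (hK : Odd (Nat.card K)) (m : ℕ) :
    0 < sigma K (2 * m) m ↔ IsSquare ((-1 : K) ^ m) := by
  rcases Nat.eq_zero_or_pos m with rfl | hm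
  · simp [sigma_zero]
  have h := sigma_even_mul hK m m hm le_rfl
  rw [Nat.sub_self, pow_zero, nu, Nat.mul_div_cancel_left _ two_pos] at h
  have hD := prod_Icc_pow_sub_one_ne_zero (K := K) m
  split_ifs at h with hs
  · refine iff_of_true (Nat.pos_of_ne_zero fun h0 => ?_) hs
    rw [h0, Nat.cast_zero, zero_mul, eq_comm, mul_eq_zero, Finset.prod_eq_zero_iff] at h
    have key : ∀ j : ℕ, j ≠ 0 → (Nat.card K : ℚ) ^ j - 1 ≠ 0 := fun j hj =>
      (sub_pos.2 (one_lt_pow₀ one_lt_card hj)).ne'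
    rcases h with h | ⟨i, hi, h⟩
    · exact mul_ne_zero (key m hm.ne') (by norm_num) h
    · rw [Finset.mem_Icc] at hi
      exact key _ (by omega) h
  · refine iff_of_false (fun h0 => ?_) hs
    rw [add_neg_cancel, mul_zero, zero_mul] at h
    exact mul_ne_zero (Nat.cast_ne_zero.2 h0.ne') hD h

end Sigma

/-! ### Codes over a mixed alphabet given by a ring and a residue field -/

/-- `K` is a quotient of `R` whose kernel is identified with `K` by means of `ι`. -/
structure IsMixedAlphabet {R K : Type*} [CommRing R] [Field K] [Algebra R K] (ι : K →ₗ[R] R) :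
    Prop where
  surjective : Function.Surjective (algebraMap R K)
  injective : Function.Injective ι
  algebraMap_eq_zero_iff : ∀ r, algebraMap R K r = 0 ↔ ∃ x, ι x = r

section Mixed

variable {R K : Type*} [CommRing R] [Field K] [Algebra R K] {N₁ N₂ k : ℕ}

/-- The Euclidean form on `R ^ N₁ ⊕ K ^ N₂`. -/
def mixedForm (ι : K →ₗ[R] R) (N₁ N₂ : ℕ) :
    ((Fin N₁ → R) × (Fin N₂ → K)) →ₗ[R] ((Fin N₁ → R) × (Fin N₂ → K)) →ₗ[R] R :=
  LinearMap.mk₂ R (fun m m' => m.1 ⬝ᵥ m'.1 + ι (m.2 ⬝ᵥ m'.2))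
    (fun m m' l => by simp only [Prod.fst_add, Prod.snd_add, add_dotProduct, map_add]; ring)
    (fun c m l => by
      simp only [Prod.smul_fst, Prod.smul_snd, smul_dotProduct, map_smul, smul_add])
    (fun m l l' => by simp only [Prod.fst_add, Prod.snd_add, dotProduct_add, map_add]; ring)
    (fun c m l => by
      simp only [Prod.smul_fst, Prod.smul_snd, dotProduct_smul, map_smul, smul_add])

variable (K) in
/-- Reduction of the first component to the residue field. -/
def mixedRes (N₁ N₂ : ℕ) : ((Fin N₁ → R) × (Fin N₂ → K)) →ₗ[R] (Fin N₁ → K) where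
  toFun m i := algebraMap R K (m.1 i)
  map_add' m m' := by ext i; simp
  map_smul' c m := by ext i; simp [Algebra.smul_def]

/-- The embedding of `K ^ N₁ ⊕ K ^ N₂` as the kernel of `mixedRes`. -/
def mixedEmb (ι : K →ₗ[R] R) (N₁ N₂ : ℕ) :
    ((Fin N₁ → K) × (Fin N₂ → K)) →ₗ[R] ((Fin N₁ → R) × (Fin N₂ → K)) :=
  (ι.compLeft (Fin N₁)).prodMap LinearMap.id

/-- A code which coincides with its dual. -/
def IsMixedSelfDual (ι : K →ₗ[R] R) (C : Submodule R ((Fin N₁ → R) × (Fin N₂ → K))) : Prop :=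
  ∀ m, m ∈ C ↔ ∀ m' ∈ C, mixedForm ι N₁ N₂ m m' = 0

theorem mixedForm_apply (ι : K →ₗ[R] R) (m m' : (Fin N₁ → R) × (Fin N₂ → K)) :
    mixedForm ι N₁ N₂ m m' = m.1 ⬝ᵥ m'.1 + ι (m.2 ⬝ᵥ m'.2) := rfl

theorem mixedForm_comm (ι : K →ₗ[R] R) (m m' : (Fin N₁ → R) × (Fin N₂ → K)) :
    mixedForm ι N₁ N₂ m m' = mixedForm ι N₁ N₂ m' m := by
  rw [mixedForm_apply, mixedForm_apply, dotProduct_comm, dotProduct_comm m.2]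

@[simp]
theorem mixedRes_apply (m : (Fin N₁ → R) × (Fin N₂ → K)) (i : Fin N₁) :
    mixedRes K N₁ N₂ m i = algebraMap R K (m.1 i) := rfl

theorem mixedEmb_snd (ι : K →ₗ[R] R) (p : (Fin N₁ → K) × (Fin N₂ → K)) :
    (mixedEmb ι N₁ N₂ p).2 = p.2 := rfl

/-- By R-linearity, ι(x) r is ι of x times the residue of r. Pairing with a residue-zero word is
thus a K-bilinear expression in residues and second components. -/
theorem mixedForm_emb (ι : K →ₗ[R] R) (p : (Fin N₁ → K) × (Fin N₂ → K))
    (m : (Fin N₁ → R) × (Fin N₂ → K)) :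
    mixedForm ι N₁ N₂ (mixedEmb ι N₁ N₂ p) m =
      ι (p.1 ⬝ᵥ mixedRes K N₁ N₂ m + p.2 ⬝ᵥ m.2) := by
  rw [mixedForm_apply, map_add]
  congr 1
  rw [dotProduct, dotProduct, map_sum]
  refine Finset.sum_congr rfl fun i _ => ?_
  rw [mixedRes_apply, mul_comm (p.1 i), ← Algebra.smul_def, map_smul, smul_eq_mul, mul_comm]
  rfl

/-- The residue code of a code. -/
def resCode (hs : Function.Surjective (algebraMap R K))
    (C : Submodule R ((Fin N₁ → R) × (Fin N₂ → K))) : Submodule K (Fin N₁ → K) where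
  carrier := {v | ∃ m ∈ C, mixedRes K N₁ N₂ m = v}
  add_mem' := by
    rintro _ _ ⟨m, hm, rfl⟩ ⟨m', hm', rfl⟩
    exact ⟨m + m', C.add_mem hm hm', map_add _ _ _⟩
  zero_mem' := ⟨0, C.zero_mem, map_zero _⟩
  smul_mem' := by
    rintro c _ ⟨m, hm, rfl⟩
    obtain ⟨r, rfl⟩ := hs c
    exact ⟨r • m, C.smul_mem r hm, by rw [map_smul, algebraMap_smul]⟩

/-- The second components of the words of a code whose first component has residue `0`. -/
def torsionCode (hs : Function.Surjective (algebraMap R K))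
    (C : Submodule R ((Fin N₁ → R) × (Fin N₂ → K))) : Submodule K (Fin N₂ → K) where
  carrier := {d | ∃ m ∈ C, mixedRes K N₁ N₂ m = 0 ∧ m.2 = d}
  add_mem' := by
    rintro _ _ ⟨m, hm, h, rfl⟩ ⟨m', hm', h', rfl⟩
    exact ⟨m + m', C.add_mem hm hm', by rw [map_add, h, h', add_zero], rfl⟩
  zero_mem' := ⟨0, C.zero_mem, map_zero _, rfl⟩
  smul_mem' := by
    rintro c _ ⟨m, hm, h, rfl⟩
    obtain ⟨r, rfl⟩ := hs c
    exact ⟨r • m, C.smul_mem r hm, by rw [map_smul, h, smul_zero], by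
      rw [algebraMap_smul, Prod.smul_snd]⟩

/-- The words with residue `0` which are orthogonal to a tuple and whose second components lie in
a given code. -/
def perpCode (ι : K →ₗ[R] R) (x : Fin k → (Fin N₁ → R) × (Fin N₂ → K))
    (U : Submodule K (Fin N₂ → K)) : Submodule R ((Fin N₁ → R) × (Fin N₂ → K)) where
  carrier := {m | mixedRes K N₁ N₂ m = 0 ∧ m.2 ∈ U ∧ ∀ i, mixedForm ι N₁ N₂ m (x i) = 0}
  add_mem' := by
    rintro m m' ⟨h1, h2, h3⟩ ⟨h1', h2', h3'⟩
    exact ⟨by rw [map_add, h1, h1', add_zero], U.add_mem h2 h2', fun i => by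
      rw [map_add, LinearMap.add_apply, h3, h3', add_zero]⟩
  zero_mem' := ⟨map_zero _, U.zero_mem, fun i => by rw [map_zero, LinearMap.zero_apply]⟩
  smul_mem' := by
    rintro c m ⟨h1, h2, h3⟩
    exact ⟨by rw [map_smul, h1, smul_zero], by
      rw [Prod.smul_snd, ← algebraMap_smul K c]; exact U.smul_mem _ h2, fun i => by
      rw [map_smul, LinearMap.smul_apply, h3, smul_zero]⟩

/-- The code generated by a tuple and the words orthogonal to it. -/
def codeOf (ι : K →ₗ[R] R) (x : Fin k → (Fin N₁ → R) × (Fin N₂ → K))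
    (U : Submodule K (Fin N₂ → K)) : Submodule R ((Fin N₁ → R) × (Fin N₂ → K)) :=
  Submodule.span R (Set.range x) ⊔ perpCode ι x U

/-- Pairwise orthogonal isotropic tuples with independent residues. -/
def IsIsotropicLift (ι : K →ₗ[R] R) (x : Fin k → (Fin N₁ → R) × (Fin N₂ → K)) : Prop :=
  IsIsotropicTuple (fun i => mixedRes K N₁ N₂ (x i)) ∧ ∀ i j, mixedForm ι N₁ N₂ (x i) (x j) = 0

/-- Tuples of words of a code whose residues form a basis of the residue code. -/
def IsLiftedBasis (hs : Function.Surjective (algebraMap R K))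
    (C : Submodule R ((Fin N₁ → R) × (Fin N₂ → K))) (x : Fin k → (Fin N₁ → R) × (Fin N₂ → K)) :
    Prop :=
  (∀ i, x i ∈ C) ∧ LinearIndependent K (fun i => mixedRes K N₁ N₂ (x i)) ∧
    Submodule.span K (Set.range fun i => mixedRes K N₁ N₂ (x i)) = resCode hs C

theorem exists_mem_span_mixedRes_eq (hs : Function.Surjective (algebraMap R K))
    {x : Fin k → (Fin N₁ → R) × (Fin N₂ → K)} {v : Fin N₁ → K}
    (hv : v ∈ Submodule.span K (Set.range fun i => mixedRes K N₁ N₂ (x i))) :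
    ∃ y ∈ Submodule.span R (Set.range x), mixedRes K N₁ N₂ y = v := by
  obtain ⟨c, rfl⟩ := (Submodule.mem_span_range_iff_exists_fun K).1 hv
  choose r hr using fun i => hs (c i)
  refine ⟨∑ i, r i • x i, Submodule.sum_mem _ fun i _ =>
    Submodule.smul_mem _ _ (Submodule.subset_span ⟨i, rfl⟩), ?_⟩
  rw [map_sum]
  refine Finset.sum_congr rfl fun i _ => ?_
  rw [map_smul, ← hr, algebraMap_smul]

theorem mixedForm_eq_zero_of_mem_span {ι : K →ₗ[R] R}
    {x : Fin k → (Fin N₁ → R) × (Fin N₂ → K)} {m y : (Fin N₁ → R) × (Fin N₂ → K)}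
    (hm : ∀ i, mixedForm ι N₁ N₂ m (x i) = 0) (hy : y ∈ Submodule.span R (Set.range x)) :
    mixedForm ι N₁ N₂ m y = 0 := by
  have h : Submodule.span R (Set.range x) ≤ LinearMap.ker (mixedForm ι N₁ N₂ m) := by
    rw [Submodule.span_le]
    rintro _ ⟨i, rfl⟩
    exact hm i
  exact h hy

theorem exists_mixedRes_eq (hs : Function.Surjective (algebraMap R K)) (v : Fin N₁ → K)
    (d : Fin N₂ → K) : ∃ m : (Fin N₁ → R) × (Fin N₂ → K), mixedRes K N₁ N₂ m = v ∧ m.2 = d := by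
  choose r hr using fun i => hs (v i)
  exact ⟨(r, d), funext hr, rfl⟩

namespace IsMixedAlphabet

variable {ι : K →ₗ[R] R} (h : IsMixedAlphabet ι)

include h

theorem mixedRes_emb (p : (Fin N₁ → K) × (Fin N₂ → K)) :
    mixedRes K N₁ N₂ (mixedEmb ι N₁ N₂ p) = 0 :=
  funext fun i => (h.algebraMap_eq_zero_iff _).2 ⟨p.1 i, rfl⟩

theorem emb_injective : Function.Injective (mixedEmb ι N₁ N₂) := by
  intro p p' hp
  rw [Prod.ext_iff] at hp
  exact Prod.ext (funext fun i => h.injective (congrFun hp.1 i)) hp.2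

theorem exists_emb_eq {m : (Fin N₁ → R) × (Fin N₂ → K)} (hm : mixedRes K N₁ N₂ m = 0) :
    ∃ a, mixedEmb ι N₁ N₂ (a, m.2) = m := by
  choose a ha using fun i => (h.algebraMap_eq_zero_iff _).1 (congrFun hm i)
  exact ⟨a, Prod.ext (funext ha) rfl⟩

theorem algebraMap_mixedForm (m m' : (Fin N₁ → R) × (Fin N₂ → K)) :
    algebraMap R K (mixedForm ι N₁ N₂ m m') =
      mixedRes K N₁ N₂ m ⬝ᵥ mixedRes K N₁ N₂ m' := by
  rw [mixedForm_apply, map_add, (h.algebraMap_eq_zero_iff (ι _)).2 ⟨_, rfl⟩, add_zero, dotProduct,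
    map_sum]
  exact Finset.sum_congr rfl fun i _ => map_mul _ _ _

theorem mixedForm_emb_eq_zero_iff (p : (Fin N₁ → K) × (Fin N₂ → K))
    (m : (Fin N₁ → R) × (Fin N₂ → K)) :
    mixedForm ι N₁ N₂ (mixedEmb ι N₁ N₂ p) m = 0 ↔
      p.1 ⬝ᵥ mixedRes K N₁ N₂ m + p.2 ⬝ᵥ m.2 = 0 := by
  rw [mixedForm_emb, map_eq_zero_iff _ h.injective]

theorem mixedForm_eq_zero_of_res {m m' : (Fin N₁ → R) × (Fin N₂ → K)}
    (hm : mixedRes K N₁ N₂ m = 0) (hm' : mixedRes K N₁ N₂ m' = 0) (hd : m.2 ⬝ᵥ m'.2 = 0) :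
    mixedForm ι N₁ N₂ m m' = 0 := by
  obtain ⟨a, ha⟩ := h.exists_emb_eq hm
  rw [← ha, h.mixedForm_emb_eq_zero_iff, hm', hd, dotProduct_zero, add_zero]

/-- The words of a code over a lifted basis. -/
theorem mem_of_isLiftedBasis {C : Submodule R ((Fin N₁ → R) × (Fin N₂ → K))}
    {x : Fin k → (Fin N₁ → R) × (Fin N₂ → K)} (hx : IsLiftedBasis h.surjective C x)
    {m : (Fin N₁ → R) × (Fin N₂ → K)} (hm : m ∈ C) :
    ∃ y ∈ Submodule.span R (Set.range x), y ∈ C ∧ mixedRes K N₁ N₂ (m - y) = 0 := by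
  have h1 : mixedRes K N₁ N₂ m ∈ Submodule.span K (Set.range fun i => mixedRes K N₁ N₂ (x i)) := by
    rw [hx.2.2]
    exact ⟨m, hm, rfl⟩
  obtain ⟨y, hy, hy'⟩ := exists_mem_span_mixedRes_eq h.surjective h1
  refine ⟨y, hy, ?_, by rw [map_sub, hy', sub_self]⟩
  exact Submodule.span_le.2 (Set.range_subset_iff.2 hx.1) hy

/-- Self-orthogonality is checked on generators. For the converse, words (ι a, 0) with a orthogonal
to the residues of x force the residue of m into their span; after subtracting an element of the
span of x, residue-zero words with second component u in U force the second component into the dual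
of U, which is U. -/
theorem isMixedSelfDual_codeOf {x : Fin k → (Fin N₁ → R) × (Fin N₂ → K)}
    (hx : IsIsotropicLift ι x) {U : Submodule K (Fin N₂ → K)}
    (hU : ∀ d, d ∈ U ↔ ∀ u ∈ U, d ⬝ᵥ u = 0) : IsMixedSelfDual ι (codeOf ι x U) := by
  intro m
  constructor
  · intro hm m' hm'
    obtain ⟨y, hy, z, hz, rfl⟩ := Submodule.mem_sup.1 hm
    obtain ⟨y', hy', z', hz', rfl⟩ := Submodule.mem_sup.1 hm'
    have e1 : mixedForm ι N₁ N₂ y y' = 0 := by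
      refine mixedForm_eq_zero_of_mem_span (fun i => ?_) hy'
      rw [mixedForm_comm]
      exact mixedForm_eq_zero_of_mem_span (hx.2 i) hy
    have e2 : mixedForm ι N₁ N₂ y z' = 0 := by
      rw [mixedForm_comm]
      exact mixedForm_eq_zero_of_mem_span hz'.2.2 hy
    have e3 : mixedForm ι N₁ N₂ z y' = 0 := mixedForm_eq_zero_of_mem_span hz.2.2 hy'
    have e4 : mixedForm ι N₁ N₂ z z' = 0 :=
      h.mixedForm_eq_zero_of_res hz.1 hz'.1 ((hU _).1 hz.2.1 _ hz'.2.1)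
    simp only [map_add, LinearMap.add_apply, e1, e2, e3, e4, add_zero]
  · intro hm
    have hxi : ∀ i, mixedForm ι N₁ N₂ m (x i) = 0 := fun i =>
      hm _ (Submodule.mem_sup_left (Submodule.subset_span ⟨i, rfl⟩))
    have h1 : mixedRes K N₁ N₂ m ∈
        Submodule.span K (Set.range fun i => mixedRes K N₁ N₂ (x i)) := by
      refine mem_span_of_perp hx.1.1 fun a ha => ?_
      have ha' : mixedEmb ι N₁ N₂ (a, 0) ∈ codeOf ι x U := by
        refine Submodule.mem_sup_right ⟨h.mixedRes_emb _, U.zero_mem, fun i => ?_⟩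
        rw [h.mixedForm_emb_eq_zero_iff, zero_dotProduct, add_zero]
        exact ha i
      have := hm _ ha'
      rw [mixedForm_comm, h.mixedForm_emb_eq_zero_iff] at this
      simpa using this
    obtain ⟨y, hy, hym⟩ := exists_mem_span_mixedRes_eq h.surjective h1
    have hres : mixedRes K N₁ N₂ (m - y) = 0 := by rw [map_sub, hym, sub_self]
    have hmx : ∀ i, mixedForm ι N₁ N₂ (m - y) (x i) = 0 := fun i => by
      rw [map_sub, LinearMap.sub_apply, hxi, mixedForm_comm,
        mixedForm_eq_zero_of_mem_span (hx.2 i) hy, sub_zero]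
    refine Submodule.mem_sup.2 ⟨y, hy, m - y, ⟨hres, (hU _).2 fun u hu => ?_, hmx⟩,
      add_sub_cancel _ _⟩
    -- Any u in U becomes the second component of a word of the code: a is chosen to cancel the
    -- pairing of u with each `x i`.
    obtain ⟨a, ha⟩ := exists_dotProduct_eq hx.1.1 fun i => -(u ⬝ᵥ (x i).2)
    have hp : mixedEmb ι N₁ N₂ (a, u) ∈ perpCode ι x U := by
      refine ⟨h.mixedRes_emb _, hu, fun i => ?_⟩
      rw [h.mixedForm_emb_eq_zero_iff, ha, neg_add_cancel]
    have h2 : mixedForm ι N₁ N₂ (mixedEmb ι N₁ N₂ (a, u)) (m - y) = 0 := by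
      rw [map_sub, mixedForm_comm, hm _ (Submodule.mem_sup_right hp),
        mixedForm_eq_zero_of_mem_span hp.2.2 hy, sub_zero]
    rw [h.mixedForm_emb_eq_zero_iff, hres, dotProduct_zero, zero_add] at h2
    rw [dotProduct_comm]
    exact h2

theorem isLiftedBasis_codeOf {x : Fin k → (Fin N₁ → R) × (Fin N₂ → K)}
    (hx : IsIsotropicLift ι x) (U : Submodule K (Fin N₂ → K)) :
    IsLiftedBasis h.surjective (codeOf ι x U) x := by
  have hmem : ∀ i, x i ∈ codeOf ι x U := fun i =>
    Submodule.mem_sup_left (Submodule.subset_span ⟨i, rfl⟩)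
  refine ⟨hmem, hx.1.1, le_antisymm ?_ ?_⟩
  · rw [Submodule.span_le]
    rintro _ ⟨i, rfl⟩
    exact ⟨x i, hmem i, rfl⟩
  · rintro _ ⟨m, hm, rfl⟩
    obtain ⟨y, hy, z, hz, rfl⟩ := Submodule.mem_sup.1 hm
    rw [map_add, hz.1, add_zero]
    induction hy using Submodule.span_induction with
    | mem y hy => obtain ⟨i, rfl⟩ := hy; exact Submodule.subset_span ⟨i, rfl⟩
    | zero => rw [map_zero]; exact Submodule.zero_mem _
    | add y y' hy hy' i i' =>
      rw [map_add]
      exact Submodule.add_mem _ (i (Submodule.mem_sup.2 ⟨y, hy, z, hz, rfl⟩))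
        (i' (Submodule.mem_sup.2 ⟨y', hy', z, hz, rfl⟩))
    | smul r y hy i =>
      rw [map_smul, ← algebraMap_smul K r]
      exact Submodule.smul_mem _ _ (i (Submodule.mem_sup.2 ⟨y, hy, z, hz, rfl⟩))

/-- Each u in U extends to a residue-zero word (ι a, u) orthogonal to x. These words give one
inclusion directly and the other by pairing, as U is its own dual. -/
theorem torsionCode_codeOf {x : Fin k → (Fin N₁ → R) × (Fin N₂ → K)}
    (hx : IsIsotropicLift ι x) {U : Submodule K (Fin N₂ → K)}
    (hU : ∀ d, d ∈ U ↔ ∀ u ∈ U, d ⬝ᵥ u = 0) : torsionCode h.surjective (codeOf ι x U) = U := by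
  refine le_antisymm ?_ fun u hu => ?_
  · rintro _ ⟨m, hm, hm0, rfl⟩
    refine (hU _).2 fun u hu => ?_
    obtain ⟨a, ha⟩ := exists_dotProduct_eq hx.1.1 fun i => -(u ⬝ᵥ (x i).2)
    have hp : mixedEmb ι N₁ N₂ (a, u) ∈ perpCode ι x U := by
      refine ⟨h.mixedRes_emb _, hu, fun i => ?_⟩
      rw [h.mixedForm_emb_eq_zero_iff, ha, neg_add_cancel]
    have h2 := (h.isMixedSelfDual_codeOf hx hU _).1 hm _ (Submodule.mem_sup_right hp)
    rw [mixedForm_comm, h.mixedForm_emb_eq_zero_iff, hm0, dotProduct_zero, zero_add] at h2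
    rw [dotProduct_comm]
    exact h2
  · obtain ⟨a, ha⟩ := exists_dotProduct_eq hx.1.1 fun i => -(u ⬝ᵥ (x i).2)
    refine ⟨mixedEmb ι N₁ N₂ (a, u), Submodule.mem_sup_right ⟨h.mixedRes_emb _, hu, fun i => ?_⟩,
      h.mixedRes_emb _, rfl⟩
    rw [h.mixedForm_emb_eq_zero_iff, ha, neg_add_cancel]

theorem isIsotropicLift_of_isLiftedBasis {C : Submodule R ((Fin N₁ → R) × (Fin N₂ → K))}
    (hC : IsMixedSelfDual ι C) {x : Fin k → (Fin N₁ → R) × (Fin N₂ → K)}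
    (hx : IsLiftedBasis h.surjective C x) : IsIsotropicLift ι x := by
  have h1 : ∀ i j, mixedForm ι N₁ N₂ (x i) (x j) = 0 := fun i j =>
    (hC _).1 (hx.1 i) _ (hx.1 j)
  refine ⟨⟨hx.2.1, fun i j => ?_⟩, h1⟩
  rw [← h.algebraMap_mixedForm, h1, map_zero]

/-- Residue-zero words pair to ι of the product of their second components. If d is orthogonal to
the torsion code, correct it to (ι a, d) orthogonal to x; every word of C is a combination of x plus
a residue-zero word of C, so the corrected word is orthogonal to C and lies in it. -/
theorem mem_torsionCode_iff {C : Submodule R ((Fin N₁ → R) × (Fin N₂ → K))}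
    (hC : IsMixedSelfDual ι C) {x : Fin k → (Fin N₁ → R) × (Fin N₂ → K)}
    (hx : IsLiftedBasis h.surjective C x) (d : Fin N₂ → K) :
    d ∈ torsionCode h.surjective C ↔ ∀ u ∈ torsionCode h.surjective C, d ⬝ᵥ u = 0 := by
  constructor
  · rintro ⟨m, hm, hm0, rfl⟩ u ⟨m', hm', hm0', rfl⟩
    obtain ⟨a, ha⟩ := h.exists_emb_eq hm0
    have := (hC _).1 hm _ hm'
    rw [← ha, h.mixedForm_emb_eq_zero_iff, hm0', dotProduct_zero, zero_add] at this
    exact this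
  · intro hd
    obtain ⟨a, ha⟩ := exists_dotProduct_eq hx.2.1 fun i => -(d ⬝ᵥ (x i).2)
    refine ⟨mixedEmb ι N₁ N₂ (a, d), (hC _).2 fun m' hm' => ?_, h.mixedRes_emb _, rfl⟩
    obtain ⟨y, hy, hyC, hy0⟩ := h.mem_of_isLiftedBasis hx hm'
    rw [← add_sub_cancel y m', map_add,
      mixedForm_eq_zero_of_mem_span (fun i => ?_) hy, zero_add, h.mixedForm_emb_eq_zero_iff, hy0,
      dotProduct_zero, zero_add]
    · exact hd _ ⟨_, C.sub_mem hm' hyC, hy0, rfl⟩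
    · rw [h.mixedForm_emb_eq_zero_iff, ha, neg_add_cancel]

/-- C is contained in the reconstructed code. Both are self-dual and duality reverses inclusions, so
they coincide. -/
theorem codeOf_torsionCode {C : Submodule R ((Fin N₁ → R) × (Fin N₂ → K))}
    (hC : IsMixedSelfDual ι C) {x : Fin k → (Fin N₁ → R) × (Fin N₂ → K)}
    (hx : IsLiftedBasis h.surjective C x) : codeOf ι x (torsionCode h.surjective C) = C := by
  have hx' := h.isIsotropicLift_of_isLiftedBasis hC hx
  have hle : C ≤ codeOf ι x (torsionCode h.surjective C) := by
    intro m hm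
    obtain ⟨y, hy, hyC, hy0⟩ := h.mem_of_isLiftedBasis hx hm
    have := C.sub_mem hm hyC
    exact Submodule.mem_sup.2 ⟨y, hy, m - y, ⟨hy0, ⟨m - y, this, hy0, rfl⟩, fun i =>
      (hC _).1 this _ (hx.1 i)⟩, add_sub_cancel _ _⟩
  refine le_antisymm (fun m hm => (hC _).2 fun m' hm' => ?_) hle
  exact (h.isMixedSelfDual_codeOf hx' (h.mem_torsionCode_iff hC hx) _).1 hm _ (hle hm')

/-- Self-dual codes with a lifted basis correspond to isotropic lifts and self-dual codes over the
residue field. -/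
def liftedBasisEquiv (k N₁ N₂ : ℕ) :
    (Σ C : {C : Submodule R ((Fin N₁ → R) × (Fin N₂ → K)) // IsMixedSelfDual ι C},
      {x : Fin k → (Fin N₁ → R) × (Fin N₂ → K) // IsLiftedBasis h.surjective C.1 x}) ≃
    {x : Fin k → (Fin N₁ → R) × (Fin N₂ → K) // IsIsotropicLift ι x} ×
      {U : Submodule K (Fin N₂ → K) // ∀ d, d ∈ U ↔ ∀ u ∈ U, d ⬝ᵥ u = 0} where
  toFun p := (⟨p.2.1, h.isIsotropicLift_of_isLiftedBasis p.1.2 p.2.2⟩,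
    ⟨torsionCode h.surjective p.1.1, h.mem_torsionCode_iff p.1.2 p.2.2⟩)
  invFun p := ⟨⟨codeOf ι p.1.1 p.2.1, h.isMixedSelfDual_codeOf p.1.2 p.2.2⟩,
    ⟨p.1.1, h.isLiftedBasis_codeOf p.1.2 p.2.1⟩⟩
  left_inv := by
    rintro ⟨⟨C, hC⟩, ⟨x, hx⟩⟩
    have := h.codeOf_torsionCode hC hx
    refine Sigma.subtype_ext (Subtype.ext this) rfl
  right_inv := by
    rintro ⟨⟨x, hx⟩, ⟨U, hU⟩⟩
    exact Prod.ext rfl (Subtype.ext (h.torsionCode_codeOf hx hU))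

end IsMixedAlphabet

end Mixed

/-- The dual of U has q ^ (n - dim U) elements, so a self-orthogonal U fills its dual exactly when
its dimension is n / 2. -/
theorem mem_iff_perp_iff {K : Type*} [Field K] [Finite K] {n : ℕ}
    (U : Submodule K (Fin n → K)) :
    (∀ d, d ∈ U ↔ ∀ u ∈ U, d ⬝ᵥ u = 0) ↔
      2 * Module.finrank K U = n ∧ IsSelfOrthogonal U := by
  let b := Module.finBasis K U
  have hb : LinearIndependent K fun i => (b i : Fin n → K) :=
    b.linearIndependent.map' U.subtype U.ker_subtype
  have hspan : Submodule.span K (Set.range fun i => (b i : Fin n → K)) = U := by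
    have h2 := congrArg (Submodule.map U.subtype) b.span_eq
    rwa [Submodule.map_span, Submodule.map_top, Submodule.range_subtype, ← Set.range_comp] at h2
  have hperp : ∀ d : Fin n → K, (∀ u ∈ U, d ⬝ᵥ u = 0) ↔
      ∀ i, d ⬝ᵥ (b i : Fin n → K) = (0 : Fin (Module.finrank K U) → K) i := fun d =>
    ⟨fun h i => h _ (b i).2, fun h u hu => dotProduct_eq_zero_of_mem_span h (hspan.ge hu)⟩
  have hcard : Nat.card {d : Fin n → K // ∀ u ∈ U, d ⬝ᵥ u = 0} =
      Nat.card K ^ (n - Module.finrank K U) := by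
    rw [← card_dotProduct_eq hb 0]
    exact Nat.card_congr (Equiv.subtypeEquivRight hperp)
  have hU : Nat.card U = Nat.card K ^ Module.finrank K U :=
    Module.natCard_eq_pow_finrank (K := K)
  have hle := le_of_linearIndependent hb
  constructor
  · intro h
    refine ⟨?_, fun v hv w hw => (h v).1 hv w hw⟩
    rw [← Nat.card_congr (Equiv.subtypeEquivRight h)] at hcard
    have := Nat.pow_right_injective (Finite.one_lt_card (α := K)) (hU.symm.trans hcard)
    omega
  · rintro ⟨h1, h2⟩ d
    refine ⟨fun hd u hu => h2 d hd u hu, fun hd => ?_⟩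
    let f : U → {d : Fin n → K // ∀ u ∈ U, d ⬝ᵥ u = 0} := fun u => ⟨u.1, h2 u.1 u.2⟩
    have hf : Function.Injective f := fun u u' h => Subtype.ext (Subtype.mk.inj h)
    have hbij : Function.Bijective f := by
      refine (Nat.bijective_iff_injective_and_card f).2 ⟨hf, ?_⟩
      rw [hcard, hU]
      congr 1
      omega
    obtain ⟨u, hu⟩ := hbij.2 ⟨d, hd⟩
    have : u.1 = d := congrArg Subtype.val hu
    rw [← this]
    exact u.2

/-- The fibre of the first projection of a sigma type. -/
def sigmaFstFiberEquiv {α : Type*} {β : α → Type*} (a : α) :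
    {p : Σ a, β a // p.1 = a} ≃ β a where
  toFun p := p.2 ▸ p.1.2
  invFun b := ⟨⟨a, b⟩, rfl⟩
  left_inv := by rintro ⟨⟨a, b⟩, rfl⟩; rfl
  right_inv _ := rfl

/-! ### Counting isotropic lifts, lifted bases and self-dual mixed codes -/

section Count

variable {R K : Type*} [CommRing R] [Field K] [Algebra R K] {N₁ N₂ k : ℕ}

theorem isIsotropicLift_snoc (ι : K →ₗ[R] R) (x : Fin k → (Fin N₁ → R) × (Fin N₂ → K))
    (m : (Fin N₁ → R) × (Fin N₂ → K)) :
    IsIsotropicLift ι (Fin.snoc (α := fun _ => (Fin N₁ → R) × (Fin N₂ → K)) x m) ↔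
      IsIsotropicLift ι x ∧
        ((mixedRes K N₁ N₂ m ∉ Submodule.span K (Set.range fun i => mixedRes K N₁ N₂ (x i)) ∧
          (∀ i, mixedRes K N₁ N₂ m ⬝ᵥ mixedRes K N₁ N₂ (x i) = 0) ∧
          mixedRes K N₁ N₂ m ⬝ᵥ mixedRes K N₁ N₂ m = 0) ∧
        (∀ i, mixedForm ι N₁ N₂ m (x i) = 0) ∧ mixedForm ι N₁ N₂ m m = 0) := by
  have e : (fun i => mixedRes K N₁ N₂
      (Fin.snoc (α := fun _ => (Fin N₁ → R) × (Fin N₂ → K)) x m i)) =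
      Fin.snoc (α := fun _ => Fin N₁ → K) (fun i => mixedRes K N₁ N₂ (x i))
        (mixedRes K N₁ N₂ m) := by
    funext i
    refine Fin.lastCases ?_ (fun i => ?_) i <;> simp
  rw [IsIsotropicLift, e, isIsotropicTuple_snoc, IsIsotropicLift]
  simp only [Fin.forall_fin_succ', Fin.snoc_castSucc, Fin.snoc_last, mixedForm_comm ι _ m,
    forall_and]
  tauto

namespace IsMixedAlphabet

variable {ι : K →ₗ[R] R} (h : IsMixedAlphabet ι)

include h

/-- The number of words with given residue and given second component which extend an isotropic
lift. -/
theorem card_lift_fiber [Finite K] (h2 : (2 : K) ≠ 0) {x : Fin k → (Fin N₁ → R) × (Fin N₂ → K)}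
    {v : Fin N₁ → K} (hv : LinearIndependent K (Fin.snoc (α := fun _ => Fin N₁ → K)
      (fun i => mixedRes K N₁ N₂ (x i)) v))
    (hvx : ∀ i, v ⬝ᵥ mixedRes K N₁ N₂ (x i) = 0) (hvv : v ⬝ᵥ v = 0) (d : Fin N₂ → K) :
    Nat.card {m : (Fin N₁ → R) × (Fin N₂ → K) // m.2 = d ∧ mixedRes K N₁ N₂ m = v ∧
      (∀ i, mixedForm ι N₁ N₂ m (x i) = 0) ∧ mixedForm ι N₁ N₂ m m = 0} =
      Nat.card K ^ (N₁ - (k + 1)) := by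
  obtain ⟨m₀, hm₀, hd⟩ := exists_mixedRes_eq h.surjective v d
  have ht : ∀ i, ∃ t, ι t = mixedForm ι N₁ N₂ m₀ (x i) := fun i =>
    (h.algebraMap_eq_zero_iff _).1 (by rw [h.algebraMap_mixedForm, hm₀, hvx])
  choose t ht using ht
  obtain ⟨s, hs⟩ : ∃ s, ι s = mixedForm ι N₁ N₂ m₀ m₀ :=
    (h.algebraMap_eq_zero_iff _).1 (by rw [h.algebraMap_mixedForm, hm₀, hvv])
  have e1 : ∀ (a : Fin N₁ → K) i,
      mixedForm ι N₁ N₂ (mixedEmb ι N₁ N₂ (a, 0) + m₀) (x i) = 0 ↔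
        a ⬝ᵥ mixedRes K N₁ N₂ (x i) = -t i := by
    intro a i
    rw [map_add, LinearMap.add_apply, mixedForm_emb, ← ht, ← map_add,
      map_eq_zero_iff _ h.injective, zero_dotProduct, add_zero, eq_neg_iff_add_eq_zero]
  -- The square of (ι a, 0) vanishes and the cross terms give 2 ι(a·v), so isotropy is a linear
  -- condition on a. Together with orthogonality to x this makes k + 1 independent equations.
  have e2 : ∀ a : Fin N₁ → K,
      mixedForm ι N₁ N₂ (mixedEmb ι N₁ N₂ (a, 0) + m₀) (mixedEmb ι N₁ N₂ (a, 0) + m₀) = 0 ↔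
        a ⬝ᵥ v = -(s / 2) := by
    intro a
    have e3 : mixedForm ι N₁ N₂ (mixedEmb ι N₁ N₂ (a, 0)) (mixedEmb ι N₁ N₂ (a, 0)) = 0 := by
      rw [h.mixedForm_emb_eq_zero_iff, h.mixedRes_emb, dotProduct_zero, zero_dotProduct, add_zero]
    rw [map_add, map_add, LinearMap.add_apply, LinearMap.add_apply, e3, zero_add,
      mixedForm_comm ι m₀ (mixedEmb ι N₁ N₂ (a, 0)), mixedForm_emb, hm₀, ← hs, ← map_add,
      ← map_add, map_eq_zero_iff _ h.injective, zero_dotProduct, add_zero]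
    constructor
    · intro h
      field_simp
      linear_combination h
    · intro h
      rw [h]
      field_simp
      ring
  rw [← card_dotProduct_eq hv (Fin.snoc (α := fun _ => K) (fun i => -t i) (-(s / 2)))]
  symm
  refine Nat.card_congr (Equiv.ofBijective
    (fun a => ⟨mixedEmb ι N₁ N₂ (a.1, 0) + m₀, ?_, ?_, fun i => ?_, ?_⟩) ⟨?_, ?_⟩)
  · rw [Prod.snd_add, mixedEmb_snd, hd, zero_add]
  · rw [map_add, h.mixedRes_emb, hm₀, zero_add]
  · rw [e1]
    simpa using a.2 i.castSucc
  · rw [e2]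
    simpa using a.2 (Fin.last k)
  · intro a a' haa
    have := h.emb_injective (add_right_cancel (Subtype.mk.inj haa))
    exact Subtype.ext (Prod.ext_iff.1 this).1
  · rintro ⟨m, hmd, hmv, hmx, hmm⟩
    obtain ⟨a, ha⟩ := h.exists_emb_eq (m := m - m₀) (by rw [map_sub, hmv, hm₀, sub_self])
    rw [Prod.snd_sub, hmd, hd, sub_self] at ha
    obtain rfl : mixedEmb ι N₁ N₂ (a, 0) + m₀ = m := by rw [ha, sub_add_cancel]
    refine ⟨⟨a, fun i => ?_⟩, rfl⟩
    refine Fin.lastCases ?_ (fun i => ?_) i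
    · rw [Fin.snoc_last, Fin.snoc_last]
      exact (e2 a).1 hmm
    · rw [Fin.snoc_castSucc, Fin.snoc_castSucc]
      exact (e1 a i).1 (hmx i)

/-- A new residue extends the residue tuple; its second component is free, with q ^ N₂ choices, and
then q ^ (N₁ - (k + 1)) first components remain. -/
theorem card_isotropicLift_succ [Finite R] [Finite K] (h2 : (2 : K) ≠ 0) (N₁ N₂ k : ℕ) :
    (Nat.card {x : Fin (k + 1) → (Fin N₁ → R) × (Fin N₂ → K) // IsIsotropicLift ι x} : ℚ) =
      Nat.card {x : Fin k → (Fin N₁ → R) × (Fin N₂ → K) // IsIsotropicLift ι x} *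
      ((Nat.card {v : Fin N₁ → K // v ⬝ᵥ v = 0} +
        ((Nat.card K : ℚ) ^ N₁ / Nat.card K ^ k - Nat.card K ^ N₁) / Nat.card K
          - Nat.card K ^ k) * ((Nat.card K : ℚ) ^ (N₁ + N₂) / Nat.card K ^ (k + 1))) := by
  have hq : (Nat.card K : ℚ) ≠ 0 := by exact_mod_cast Nat.card_pos.ne'
  refine card_snoc (isIsotropicLift_snoc ι) fun x hx => ?_
  rw [← card_isotropic_extension h2 _ hx.1]
  refine card_eq_mul_of_card_fibers (fun m => (⟨mixedRes K N₁ N₂ m.1, m.2.1⟩ :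
    {v : Fin N₁ → K // v ∉ Submodule.span K (Set.range fun i => mixedRes K N₁ N₂ (x i)) ∧
      (∀ i, v ⬝ᵥ mixedRes K N₁ N₂ (x i) = 0) ∧ v ⬝ᵥ v = 0})) ?_
  rintro ⟨v, hv, hvx, hvv⟩
  have hli : LinearIndependent K (Fin.snoc (α := fun _ => Fin N₁ → K)
      (fun i => mixedRes K N₁ N₂ (x i)) v) := linearIndependent_finSnoc.2 ⟨hx.1.1, hv⟩
  have hk := le_of_linearIndependent hli
  have h1 : Nat.card {m : (Fin N₁ → R) × (Fin N₂ → K) // mixedRes K N₁ N₂ m = v ∧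
      (∀ i, mixedForm ι N₁ N₂ m (x i) = 0) ∧ mixedForm ι N₁ N₂ m m = 0} =
      (Nat.card K ^ N₂ * Nat.card K ^ (N₁ - (k + 1)) : ℚ) := by
    have e := card_eq_mul_of_card_fibers (c := (Nat.card K ^ (N₁ - (k + 1)) : ℕ))
      (fun m : {m : (Fin N₁ → R) × (Fin N₂ → K) // mixedRes K N₁ N₂ m = v ∧
        (∀ i, mixedForm ι N₁ N₂ m (x i) = 0) ∧ mixedForm ι N₁ N₂ m m = 0} => m.1.2)
      fun d => by
        rw [← h.card_lift_fiber h2 hli hvx hvv d]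
        congr 1
        refine Nat.card_congr ((Equiv.subtypeSubtypeEquivSubtypeInter _
          (fun m : (Fin N₁ → R) × (Fin N₂ → K) => m.2 = d)).trans
            (Equiv.subtypeEquivRight fun m => and_comm))
    rw [e, Nat.card_fun, Nat.card_fin]
    push_cast
    rfl
  rw [pow_sub₀ _ hq hk, ← mul_assoc, ← pow_add, add_comm N₂, ← div_eq_mul_inv] at h1
  rw [← h1]
  congr 1
  refine Nat.card_congr ((Equiv.subtypeEquivRight fun m => Subtype.ext_iff).trans
    ((Equiv.subtypeSubtypeEquivSubtypeInter _
      (fun m : (Fin N₁ → R) × (Fin N₂ → K) => mixedRes K N₁ N₂ m = v)).trans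
        (Equiv.subtypeEquivRight fun m => ?_)))
  constructor
  · rintro ⟨⟨-, h3⟩, h4⟩
    exact ⟨h4, h3⟩
  · rintro ⟨rfl, h3⟩
    exact ⟨⟨⟨hv, hvx, hvv⟩, h3⟩, rfl⟩

theorem card_isotropicLift [Finite R] [Finite K] (h2 : (2 : K) ≠ 0) (N₁ N₂ k : ℕ) :
    (Nat.card {x : Fin k → (Fin N₁ → R) × (Fin N₂ → K) // IsIsotropicLift ι x} : ℚ) *
        (Nat.card K : ℚ) ^ (∑ i ∈ Finset.range k, (i + 1)) =
      Nat.card {e : Fin k → Fin N₁ → K // IsIsotropicTuple e} *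
        (Nat.card K : ℚ) ^ ((N₁ + N₂) * k) := by
  have hq : (Nat.card K : ℚ) ≠ 0 := by exact_mod_cast Nat.card_pos.ne'
  induction k with
  | zero =>
    have : Unique {e : Fin 0 → Fin N₁ → K // IsIsotropicTuple e} :=
      ⟨⟨⟨Fin.elim0, linearIndependent_empty_type, fun i => i.elim0⟩⟩, fun v =>
        Subtype.ext (Subsingleton.elim _ _)⟩
    have : Unique {x : Fin 0 → (Fin N₁ → R) × (Fin N₂ → K) // IsIsotropicLift ι x} :=
      ⟨⟨⟨Fin.elim0, ⟨linearIndependent_empty_type, fun i => i.elim0⟩, fun i => i.elim0⟩⟩, fun v =>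
        Subtype.ext (Subsingleton.elim _ _)⟩
    simp
  | succ k ih =>
    rw [h.card_isotropicLift_succ h2, card_isotropicTuple_succ h2, Finset.sum_range_succ,
      pow_add (Nat.card K : ℚ), mul_add (N₁ + N₂), pow_add (Nat.card K : ℚ) ((N₁ + N₂) * k),
      mul_one]
    generalize (Nat.card {v : Fin N₁ → K // v ⬝ᵥ v = 0} +
        ((Nat.card K : ℚ) ^ N₁ / Nat.card K ^ k - Nat.card K ^ N₁) / Nat.card K
          - Nat.card K ^ k) = E
    field_simp
    linear_combination E * (Nat.card K : ℚ) ^ (N₁ + N₂) * (Nat.card K : ℚ) ^ (k + 1) * ih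

/-- The number of words of a self-dual code with a given residue. -/
theorem card_residue_fiber [Finite R] [Finite K] {C : Submodule R ((Fin N₁ → R) × (Fin N₂ → K))}
    (hC : IsMixedSelfDual ι C) {x : Fin k → (Fin N₁ → R) × (Fin N₂ → K)}
    (hx : IsLiftedBasis h.surjective C x) {v : Fin N₁ → K} (hv : v ∈ resCode h.surjective C) :
    Nat.card {m : (Fin N₁ → R) × (Fin N₂ → K) // m ∈ C ∧ mixedRes K N₁ N₂ m = v} =
      Nat.card K ^ (N₁ - k + N₂ / 2) := by
  obtain ⟨m₀, hm₀, rfl⟩ := hv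
  have hU := (mem_iff_perp_iff _).1 (h.mem_torsionCode_iff hC hx)
  have hUcard : Nat.card (torsionCode h.surjective C) = Nat.card K ^ (N₂ / 2) := by
    rw [Module.natCard_eq_pow_finrank (K := K)]
    congr 1
    omega
  have e1 : Nat.card {m : (Fin N₁ → R) × (Fin N₂ → K) //
      m ∈ C ∧ mixedRes K N₁ N₂ m = mixedRes K N₁ N₂ m₀} =
      Nat.card {m : (Fin N₁ → R) × (Fin N₂ → K) // m ∈ C ∧ mixedRes K N₁ N₂ m = 0} := by
    refine Nat.card_congr (Equiv.subtypeEquiv (Equiv.subRight m₀) fun m => ?_)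
    rw [Equiv.subRight_apply, map_sub, sub_eq_zero, C.sub_mem_iff_left hm₀]
  -- By self-duality, (ι a, 0) lies in C exactly when a is orthogonal to the residue code. Hence
  -- each fibre of the map from residue-zero words to the torsion code has q ^ (N₁ - k) elements.
  have hmem : ∀ a : Fin N₁ → K, mixedEmb ι N₁ N₂ (a, 0) ∈ C ↔
      ∀ i, a ⬝ᵥ mixedRes K N₁ N₂ (x i) = 0 := by
    intro a
    have e2 : ∀ m', mixedForm ι N₁ N₂ (mixedEmb ι N₁ N₂ (a, 0)) m' = 0 ↔
        a ⬝ᵥ mixedRes K N₁ N₂ m' = 0 := fun m' => by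
      rw [h.mixedForm_emb_eq_zero_iff, zero_dotProduct, add_zero]
    rw [hC]
    simp only [e2]
    refine ⟨fun H i => H _ (hx.1 i), fun H m' hm' => dotProduct_eq_zero_of_mem_span H ?_⟩
    rw [hx.2.2]
    exact ⟨m', hm', rfl⟩
  have e3 := card_eq_mul_of_card_fibers (c := (Nat.card K ^ (N₁ - k) : ℕ))
    (fun m : {m : (Fin N₁ → R) × (Fin N₂ → K) // m ∈ C ∧ mixedRes K N₁ N₂ m = 0} =>
      (⟨m.1.2, ⟨m.1, m.2.1, m.2.2, rfl⟩⟩ : torsionCode h.surjective C)) fun d => by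
    obtain ⟨d, m₁, hm₁, hm₁0, rfl⟩ := d
    rw [← card_dotProduct_eq hx.2.1 0]
    congr 1
    symm
    refine Nat.card_congr (Equiv.ofBijective
      (fun a => ⟨⟨mixedEmb ι N₁ N₂ (a.1, 0) + m₁, C.add_mem ((hmem a.1).2 a.2) hm₁, ?_⟩, ?_⟩)
      ⟨?_, ?_⟩)
    · rw [map_add, h.mixedRes_emb, hm₁0, add_zero]
    · apply Subtype.ext
      change (mixedEmb ι N₁ N₂ (a.1, 0) + m₁).2 = m₁.2
      rw [Prod.snd_add, mixedEmb_snd, zero_add]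
    · intro a a' haa
      have := h.emb_injective (add_right_cancel (Subtype.mk.inj (Subtype.mk.inj haa)))
      exact Subtype.ext (Prod.ext_iff.1 this).1
    · rintro ⟨⟨m, hm, hm0⟩, hmd⟩
      have hmd : m.2 = m₁.2 := congrArg Subtype.val hmd
      obtain ⟨a, ha⟩ := h.exists_emb_eq (m := m - m₁) (by rw [map_sub, hm0, hm₁0, sub_self])
      rw [Prod.snd_sub, hmd, sub_self] at ha
      obtain rfl : mixedEmb ι N₁ N₂ (a, 0) + m₁ = m := by rw [ha, sub_add_cancel]
      exact ⟨⟨a, (hmem a).1 (by rw [ha]; exact C.sub_mem hm hm₁)⟩, rfl⟩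
  rw [hUcard] at e3
  rw [e1, pow_add, mul_comm]
  exact_mod_cast e3

theorem exists_isLiftedBasis (C : Submodule R ((Fin N₁ → R) × (Fin N₂ → K))) :
    ∃ x : Fin (Module.finrank K (resCode h.surjective C)) → (Fin N₁ → R) × (Fin N₂ → K),
      IsLiftedBasis h.surjective C x := by
  let b := Module.finBasis K (resCode h.surjective C)
  choose x hx hxb using fun i => (b i).2
  have hxb' : (fun i => mixedRes K N₁ N₂ (x i)) = fun i => (b i : Fin N₁ → K) := funext hxb
  refine ⟨x, hx, ?_, ?_⟩
  · rw [hxb']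
    exact b.linearIndependent.map' (Submodule.subtype _) (Submodule.ker_subtype _)
  · rw [hxb']
    have h2 := congrArg (Submodule.map (resCode h.surjective C).subtype) b.span_eq
    rwa [Submodule.map_span, Submodule.map_top, Submodule.range_subtype, ← Set.range_comp] at h2

theorem finrank_resCode_of_isLiftedBasis {C : Submodule R ((Fin N₁ → R) × (Fin N₂ → K))}
    {x : Fin k → (Fin N₁ → R) × (Fin N₂ → K)} (hx : IsLiftedBasis h.surjective C x) :
    Module.finrank K (resCode h.surjective C) = k := by
  rw [← hx.2.2, finrank_span_eq_card hx.2.1, Fintype.card_fin]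

/-- A basis of the residue code is chosen first, and then each of its k vectors is lifted to C
independently. -/
theorem card_isLiftedBasis [Finite R] [Finite K] {C : Submodule R ((Fin N₁ → R) × (Fin N₂ → K))}
    (hC : IsMixedSelfDual ι C) (hk : Module.finrank K (resCode h.surjective C) = k) :
    Nat.card {x : Fin k → (Fin N₁ → R) × (Fin N₂ → K) // IsLiftedBasis h.surjective C x} =
      (∏ i : Fin k, (Nat.card K ^ k - Nat.card K ^ (i : ℕ))) *
        (Nat.card K ^ (N₁ - k + N₂ / 2)) ^ k := by
  subst hk
  obtain ⟨x₀, hx₀⟩ := h.exists_isLiftedBasis C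
  rw [← card_bases_of_finrank (resCode h.surjective C) rfl]
  have e := card_eq_mul_of_card_fibers
    (c := ((Nat.card K ^ (N₁ - Module.finrank K (resCode h.surjective C) + N₂ / 2)) ^
      Module.finrank K (resCode h.surjective C) : ℕ))
    (fun x : {x : Fin (Module.finrank K (resCode h.surjective C)) →
        (Fin N₁ → R) × (Fin N₂ → K) // IsLiftedBasis h.surjective C x} =>
      (⟨fun i => mixedRes K N₁ N₂ (x.1 i), x.2.2⟩ :
        {e : Fin (Module.finrank K (resCode h.surjective C)) → Fin N₁ → K //
          LinearIndependent K e ∧ Submodule.span K (Set.range e) = resCode h.surjective C}))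
    fun e => by
      have he : ∀ i, e.1 i ∈ resCode h.surjective C := fun i =>
        e.2.2.le (Submodule.subset_span ⟨i, rfl⟩)
      have e2 : Nat.card (∀ i, {m : (Fin N₁ → R) × (Fin N₂ → K) //
          m ∈ C ∧ mixedRes K N₁ N₂ m = e.1 i}) =
          (Nat.card K ^ (N₁ - Module.finrank K (resCode h.surjective C) + N₂ / 2)) ^
            Module.finrank K (resCode h.surjective C) := by
        rw [Nat.card_pi, Finset.prod_congr rfl fun i _ => h.card_residue_fiber hC hx₀ (he i)]
        simp
      rw [← e2]
      congr 1
      refine Nat.card_congr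
        ⟨fun x i => ⟨x.1.1 i, x.1.2.1 i, congrFun (congrArg Subtype.val x.2) i⟩,
          fun y => ⟨⟨fun i => (y i).1, fun i => (y i).2.1, ?_⟩, ?_⟩, fun x => rfl, fun y => rfl⟩
      · rw [show (fun i => mixedRes K N₁ N₂ (y i).1) = e.1 from funext fun i => (y i).2.2]
        exact e.2
      · exact Subtype.ext (funext fun i => (y i).2.2)
  exact_mod_cast e

/-- The number of self-dual codes whose residue code has a given dimension. -/
theorem card_selfDual_of_finrank [Finite R] [Finite K] (h2 : (2 : K) ≠ 0) {N₁ m k : ℕ} (hk : k ≤ N₁) :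
    Nat.card {C : {C : Submodule R ((Fin N₁ → R) × (Fin (2 * m) → K)) // IsMixedSelfDual ι C} //
        Module.finrank K (resCode h.surjective C.1) = k} =
      sigma K N₁ k * sigma K (2 * m) m * Nat.card K ^ (k * (2 * m + k - 1) / 2) := by
  have hB := prod_card_pow_sub_pos (K := K) k
  have hq : 0 < Nat.card K := Nat.card_pos
  -- Pairs of a code and a lifted basis are counted in two ways: here by isotropic lifts and torsion
  -- codes, in `e4` by codes and their lifted bases.
  have e1 := Nat.card_congr (h.liftedBasisEquiv k N₁ (2 * m))
  have e2 : Nat.card {U : Submodule K (Fin (2 * m) → K) // ∀ d, d ∈ U ↔ ∀ u ∈ U, d ⬝ᵥ u = 0} =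
      sigma K (2 * m) m := by
    refine Nat.card_congr (Equiv.subtypeEquivRight fun U => ?_)
    rw [mem_iff_perp_iff, Nat.mul_right_inj two_ne_zero]
  have e3 := h.card_isotropicLift h2 N₁ (2 * m) k
  rw [card_isotropicTuple] at e3
  have e3' : Nat.card {x : Fin k → (Fin N₁ → R) × (Fin (2 * m) → K) // IsIsotropicLift ι x} *
        Nat.card K ^ (∑ i ∈ Finset.range k, (i + 1)) =
      sigma K N₁ k * (∏ i : Fin k, (Nat.card K ^ k - Nat.card K ^ (i : ℕ))) *
        Nat.card K ^ ((N₁ + 2 * m) * k) := by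
    exact_mod_cast e3
  let F : (Σ C : {C : Submodule R ((Fin N₁ → R) × (Fin (2 * m) → K)) // IsMixedSelfDual ι C},
      {x : Fin k → (Fin N₁ → R) × (Fin (2 * m) → K) // IsLiftedBasis h.surjective C.1 x}) →
    {C : {C : Submodule R ((Fin N₁ → R) × (Fin (2 * m) → K)) // IsMixedSelfDual ι C} //
        Module.finrank K (resCode h.surjective C.1) = k} := fun p =>
      ⟨p.1, h.finrank_resCode_of_isLiftedBasis p.2.2⟩
  have e4 := card_eq_mul_of_card_fibers F
    (c := ((∏ i : Fin k, (Nat.card K ^ k - Nat.card K ^ (i : ℕ))) *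
        (Nat.card K ^ (N₁ - k + m)) ^ k : ℕ)) fun C => by
      have e5 := h.card_isLiftedBasis C.1.2 C.2
      rw [Nat.mul_div_cancel_left _ two_pos] at e5
      rw [← e5]
      congr 1
      refine Nat.card_congr ((Equiv.subtypeEquivRight fun p => Subtype.ext_iff).trans
        (sigmaFstFiberEquiv C.1))
  have e5 : Nat.card (Σ C : {C : Submodule R ((Fin N₁ → R) × (Fin (2 * m) → K)) //
      IsMixedSelfDual ι C}, {x : Fin k → (Fin N₁ → R) × (Fin (2 * m) → K) //
        IsLiftedBasis h.surjective C.1 x}) =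
      Nat.card {C : {C : Submodule R ((Fin N₁ → R) × (Fin (2 * m) → K)) // IsMixedSelfDual ι C} //
        Module.finrank K (resCode h.surjective C.1) = k} *
      ((∏ i : Fin k, (Nat.card K ^ k - Nat.card K ^ (i : ℕ))) *
        (Nat.card K ^ (N₁ - k + m)) ^ k) := by
    exact_mod_cast e4
  rw [Nat.card_prod, e2, e5] at e1
  -- What remains is mk + k² - k(k + 1)/2 = k(2m + k - 1)/2, an integer because k(k - 1) is even.
  -- The case k = 0 is separate because of the truncated k - 1.
  have e6 : (N₁ + 2 * m) * k =
      (N₁ - k + m) * k + k * (2 * m + k - 1) / 2 + ∑ i ∈ Finset.range k, (i + 1) := by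
    obtain ⟨r, rfl⟩ := Nat.exists_eq_add_of_le hk
    have hsum := Finset.sum_range_succ' (fun i => i) k
    rw [add_zero, Finset.sum_range_id] at hsum
    rw [Nat.add_sub_cancel_left, ← hsum]
    rcases Nat.eq_zero_or_pos k with rfl | hk0
    · simp
    obtain ⟨k, rfl⟩ := Nat.exists_eq_add_of_le' hk0
    obtain ⟨t, ht⟩ := even_iff_two_dvd.1 (Nat.even_mul_succ_self k)
    rw [show (k + 1) * (2 * m + (k + 1) - 1) = 2 * ((k + 1) * m + t) by
      rw [show 2 * m + (k + 1) - 1 = 2 * m + k by omega]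
      linear_combination ht, show (k + 1 + 1) * (k + 1 + 1 - 1) = 2 * (t + k + 1) by
      rw [Nat.add_sub_cancel]
      linear_combination ht, Nat.mul_div_cancel_left _ two_pos, Nat.mul_div_cancel_left _ two_pos]
    nlinarith
  have hS : 0 < Nat.card K ^ ((N₁ - k + m) * k + ∑ i ∈ Finset.range k, (i + 1)) :=
    pow_pos hq _
  apply Nat.eq_of_mul_eq_mul_right (Nat.mul_pos hB hS)
  rw [e6, pow_add, pow_add] at e3'
  rw [← pow_mul] at e1
  rw [pow_add]
  generalize Nat.card {C : {C : Submodule R ((Fin N₁ → R) × (Fin (2 * m) → K)) //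
    IsMixedSelfDual ι C} // Module.finrank K (resCode h.surjective C.1) = k} = A at e1 ⊢
  linear_combination Nat.card K ^ (∑ i ∈ Finset.range k, (i + 1)) * e1 + sigma K (2 * m) m * e3'

theorem two_mul_finrank_resCode_le [Finite K] {C : Submodule R ((Fin N₁ → R) × (Fin N₂ → K))}
    (hC : IsMixedSelfDual ι C) : 2 * Module.finrank K (resCode h.surjective C) ≤ N₁ := by
  refine IsSelfOrthogonal.two_mul_finrank_le ?_
  rintro _ ⟨m, hm, rfl⟩ _ ⟨m', hm', rfl⟩
  exact (h.algebraMap_mixedForm m m').symm.trans (by rw [(hC m).1 hm m' hm', map_zero])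

theorem card_selfDual [Finite R] [Finite K] (h2 : (2 : K) ≠ 0) (N₁ m : ℕ) :
    Nat.card {C : Submodule R ((Fin N₁ → R) × (Fin (2 * m) → K)) // IsMixedSelfDual ι C} =
      ∑ k₀ ∈ Finset.range (N₁ / 2 + 1),
        sigma K N₁ k₀ * sigma K (2 * m) m * Nat.card K ^ (k₀ * (2 * m + k₀ - 1) / 2) := by
  let f : {C : Submodule R ((Fin N₁ → R) × (Fin (2 * m) → K)) // IsMixedSelfDual ι C} →
      Fin (N₁ / 2 + 1) := fun C => ⟨Module.finrank K (resCode h.surjective C.1), by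
    have := h.two_mul_finrank_resCode_le C.2
    omega⟩
  rw [card_eq_sum_card_fibers f, Finset.sum_range]
  refine Finset.sum_congr rfl fun k₀ _ => ?_
  rw [← h.card_selfDual_of_finrank h2 (by omega)]
  exact Nat.card_congr (Equiv.subtypeEquivRight fun C => Fin.ext_iff)

/-- The torsion code of a self-dual code is self-dual over K, which forces N₂ even and `sigma K N₂
(N₂ / 2)` positive. Conversely, a self-dual U and the empty tuple give a code with zero residue
code. -/
theorem exists_selfDual_iff [Finite R] [Finite K] (hK : Odd (Nat.card K)) (N₁ N₂ : ℕ) :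
    (∃ C : Submodule R ((Fin N₁ → R) × (Fin N₂ → K)), IsMixedSelfDual ι C) ↔
      Even N₂ ∧ IsSquare ((-1 : K) ^ (N₂ / 2)) := by
  constructor
  · rintro ⟨C, hC⟩
    obtain ⟨x, hx⟩ := h.exists_isLiftedBasis C
    obtain ⟨hU1, hU2⟩ := (mem_iff_perp_iff _).1 (h.mem_torsionCode_iff hC hx)
    obtain ⟨m, hm⟩ : ∃ m, Module.finrank K (torsionCode h.surjective C) = m := ⟨_, rfl⟩
    rw [hm] at hU1
    subst hU1
    rw [Nat.mul_div_cancel_left _ two_pos, ← sigma_half_pos_iff hK]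
    have : Nonempty {U : Submodule K (Fin (2 * m) → K) //
      Module.finrank K U = m ∧ IsSelfOrthogonal U} := ⟨⟨_, hm, hU2⟩⟩
    exact ⟨even_two_mul _, Nat.card_pos⟩
  · rintro ⟨h1, h2⟩
    obtain ⟨m, rfl⟩ := even_iff_two_dvd.1 h1
    rw [Nat.mul_div_cancel_left _ two_pos, ← sigma_half_pos_iff hK] at h2
    obtain ⟨⟨U, hU1, hU2⟩⟩ := (Nat.card_pos_iff.1 h2).1
    exact ⟨_, h.isMixedSelfDual_codeOf (k := 0) (x := Fin.elim0)
      ⟨⟨linearIndependent_empty_type, fun i => i.elim0⟩, fun i => i.elim0⟩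
      ((mem_iff_perp_iff U).2 ⟨by rw [hU1], hU2⟩)⟩

end IsMixedAlphabet

end Count

/-! ### Chain rings of index two -/

section ChainRing

variable {R : Type*} [CommRing R] [IsLocalRing R] {γ : R}

/-- The embedding `x ↦ γ x` of the residue field as the maximal ideal. -/
noncomputable def IsChainRingOfIndexTwo.embed (hR : IsChainRingOfIndexTwo R γ) :
    IsLocalRing.ResidueField R →ₗ[R] R where
  toFun x := γ * lift x
  map_add' x y := by
    obtain ⟨a, rfl⟩ := IsLocalRing.residue_surjective x
    obtain ⟨b, rfl⟩ := IsLocalRing.residue_surjective y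
    rw [← map_add, gamma_mul_lift_residue hR, gamma_mul_lift_residue hR,
      gamma_mul_lift_residue hR, mul_add]
  map_smul' c x := by
    obtain ⟨a, rfl⟩ := IsLocalRing.residue_surjective x
    rw [Algebra.smul_def, IsLocalRing.ResidueField.algebraMap_eq, ← map_mul,
      gamma_mul_lift_residue hR, gamma_mul_lift_residue hR, RingHom.id_apply, smul_eq_mul,
      mul_left_comm]

theorem IsChainRingOfIndexTwo.embed_residue (hR : IsChainRingOfIndexTwo R γ) (a : R) :
    hR.embed (IsLocalRing.residue R a) = γ * a := gamma_mul_lift_residue hR a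

/-- If γ a = 0 then a is not a unit, since γ ≠ 0, so the residue of a is 0; this is the injectivity
of x ↦ γ x. -/
theorem IsChainRingOfIndexTwo.isMixedAlphabet (hR : IsChainRingOfIndexTwo R γ) :
    IsMixedAlphabet hR.embed where
  surjective := IsLocalRing.residue_surjective
  injective := by
    rw [injective_iff_map_eq_zero]
    intro x hx
    obtain ⟨a, rfl⟩ := IsLocalRing.residue_surjective x
    rw [hR.embed_residue] at hx
    rw [IsLocalRing.residue_eq_zero_iff]
    by_contra ha
    rw [IsLocalRing.notMem_maximalIdeal] at ha
    exact hR.ne_zero (ha.mul_left_eq_zero.1 hx)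
  algebraMap_eq_zero_iff r := by
    rw [IsLocalRing.ResidueField.algebraMap_eq, IsLocalRing.residue_eq_zero_iff,
      hR.maximalIdeal_eq, Ideal.mem_span_singleton]
    constructor
    · rintro ⟨c, rfl⟩
      exact ⟨_, hR.embed_residue c⟩
    · rintro ⟨x, rfl⟩
      exact ⟨lift x, rfl⟩

theorem euclForm_eq_mixedForm (hR : IsChainRingOfIndexTwo R γ) {N₁ N₂ : ℕ}
    (m m' : MixedSpace R N₁ N₂) : euclForm γ m m' = mixedForm hR.embed N₁ N₂ m m' := by
  have h : m.2 ⬝ᵥ m'.2 = IsLocalRing.residue R (∑ j, lift (m.2 j) * lift (m'.2 j)) := by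
    have hl : ∀ x : IsLocalRing.ResidueField R, IsLocalRing.residue R (lift x) = x := fun x =>
      Function.surjInv_eq IsLocalRing.residue_surjective _
    simp only [map_sum, map_mul, hl]
    rfl
  rw [mixedForm_apply, h, hR.embed_residue]
  rfl

theorem isEuclSelfDual_iff (hR : IsChainRingOfIndexTwo R γ) {N₁ N₂ : ℕ}
    (C : Submodule R (MixedSpace R N₁ N₂)) :
    IsEuclSelfDual γ C ↔ IsMixedSelfDual hR.embed C := by
  rw [IsEuclSelfDual, Set.ext_iff]
  refine forall_congr' fun m => iff_congr Iff.rfl (forall₂_congr fun m' _ => ?_)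
  rw [euclForm_eq_mixedForm hR]

end ChainRing

/-! ### The ring of integers modulo the square of a prime -/

section ZModSq

variable (p : ℕ)

theorem redHom_surjective : Function.Surjective (redHom p) :=
  ZMod.castHom_surjective _

/-- The embedding `x ↦ p x` of `ZMod p` into `ZMod (p ^ 2)`. -/
def zmodEmbed : ZMod p →+ ZMod (p ^ 2) :=
  ZMod.lift p ⟨(AddMonoidHom.mulLeft (p : ZMod (p ^ 2))).comp (Int.castAddHom _), by
    have : (p : ZMod (p ^ 2)) * p = 0 := by
      rw [← sq, ← Nat.cast_pow]
      exact ZMod.natCast_self _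
    simp only [AddMonoidHom.comp_apply, Int.coe_castAddHom, Int.cast_natCast,
      AddMonoidHom.coe_mulLeft, this]⟩

theorem zmodEmbed_intCast (z : ℤ) : zmodEmbed p z = p * z := by
  rw [zmodEmbed, ZMod.lift_coe]
  rfl

theorem zmodEmbed_natCast (z : ℕ) : zmodEmbed p z = p * z := by
  simpa using zmodEmbed_intCast p z

variable [Fact p.Prime]

instance neZero_sq : NeZero (p ^ 2) := ⟨pow_ne_zero 2 (Fact.out : p.Prime).ne_zero⟩

instance nontrivial_zmod_sq : Nontrivial (ZMod (p ^ 2)) :=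
  ZMod.nontrivial_iff.2 (Nat.one_lt_pow two_ne_zero (Fact.out : p.Prime).one_lt).ne'

/-- `ZMod p` as an algebra over `ZMod (p ^ 2)`. -/
abbrev zmodAlgebra : Algebra (ZMod (p ^ 2)) (ZMod p) := (redHom p).toAlgebra

attribute [local instance] zmodAlgebra

/-- The linear embedding `x ↦ p x` of `ZMod p` into `ZMod (p ^ 2)`. -/
def zmodLinearEmbed : ZMod p →ₗ[ZMod (p ^ 2)] ZMod (p ^ 2) :=
  (zmodEmbed p).toZModLinearMap (p ^ 2)

theorem zmodLinearEmbed_apply (x : ZMod p) : zmodLinearEmbed p x = zmodEmbed p x := rfl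

theorem redHom_eq_zero_iff (r : ZMod (p ^ 2)) : redHom p r = 0 ↔ ∃ c, r = p * c := by
  constructor
  · intro h
    obtain ⟨z, rfl⟩ := ZMod.natCast_zmod_surjective r
    rw [map_natCast, ZMod.natCast_eq_zero_iff] at h
    obtain ⟨c, rfl⟩ := h
    exact ⟨c, by push_cast; rfl⟩
  · rintro ⟨c, rfl⟩
    rw [map_mul, map_natCast, ZMod.natCast_self, zero_mul]

theorem isMixedAlphabet_zmod : IsMixedAlphabet (zmodLinearEmbed p) where
  surjective := redHom_surjective p
  injective := by
    rw [injective_iff_map_eq_zero]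
    intro x hx
    obtain ⟨z, rfl⟩ := ZMod.natCast_zmod_surjective x
    rw [zmodLinearEmbed_apply, zmodEmbed_natCast, ← Nat.cast_mul, ZMod.natCast_eq_zero_iff, sq,
      Nat.mul_dvd_mul_iff_left (Fact.out : p.Prime).pos] at hx
    rwa [ZMod.natCast_eq_zero_iff]
  algebraMap_eq_zero_iff r := by
    refine (redHom_eq_zero_iff p r).trans ?_
    constructor
    · rintro ⟨c, rfl⟩
      obtain ⟨z, rfl⟩ := ZMod.natCast_zmod_surjective c
      exact ⟨z, zmodEmbed_natCast p z⟩
    · rintro ⟨x, rfl⟩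
      obtain ⟨z, rfl⟩ := ZMod.natCast_zmod_surjective x
      exact ⟨z, zmodEmbed_natCast p z⟩

end ZModSq

theorem eq_sum_range_of_degree_lt {S : Type*} [Semiring S] {f : S[X]} {n : ℕ}
    (hf : f.degree < n) : f = ∑ i ∈ Finset.range n, C (f.coeff i) * X ^ i := by
  ext j
  rw [finsetSum_coeff]
  simp only [coeff_C_mul_X_pow, Finset.sum_ite_eq, Finset.mem_range]
  split_ifs with hj
  · rfl
  · exact coeff_eq_zero_of_degree_lt (hf.trans_le (by exact_mod_cast not_lt.1 hj))

/-! ### Coordinates on Eisenstein extensions -/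

namespace EisensteinData

variable {p r k t : ℕ} (D : EisensteinData p r k t)

theorem nontrivial_GR : Nontrivial D.GR := by
  refine nontrivial_of_ne 1 0 fun h => ?_
  rw [← map_one (AdjoinRoot.mk D.h), AdjoinRoot.mk_eq_zero] at h
  have := Polynomial.map_dvd (redHom p) h
  rw [Polynomial.map_one] at this
  exact D.irreducible_h.not_isUnit (isUnit_of_dvd_one this)

theorem degree_h [Fact p.Prime] : D.h.degree = r := by
  rw [degree_eq_natDegree D.monic_h.ne_zero, D.natDegree_h]

theorem mk_modByMonicHom (x : D.GR) :
    AdjoinRoot.mk D.h (AdjoinRoot.modByMonicHom D.monic_h x) = x :=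
  AdjoinRoot.mk_leftInverse D.monic_h x

theorem eq_sum_grCoord [Fact p.Prime] (x : D.GR) :
    x = ∑ s : Fin r, AdjoinRoot.mk D.h (C (D.grCoord s x) * X ^ (s : ℕ)) := by
  conv_lhs => rw [← D.mk_modByMonicHom x]
  rw [← map_sum]
  congr 1
  have hdeg : (AdjoinRoot.modByMonicHom D.monic_h x).degree < (r : WithBot ℕ) := by
    obtain ⟨f, rfl⟩ := AdjoinRoot.mk_surjective x
    rw [AdjoinRoot.modByMonicHom_mk, ← D.degree_h]
    exact degree_modByMonic_lt _ D.monic_h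
  exact (eq_sum_range_of_degree_lt hdeg).trans (Finset.sum_range _)

theorem grCoord_sum [Fact p.Prime] (w : Fin r → ZMod (p ^ 2)) (s : Fin r) :
    D.grCoord s (∑ i : Fin r, AdjoinRoot.mk D.h (C (w i) * X ^ (i : ℕ))) = w s := by
  have hdeg : (∑ i : Fin r, C (w i) * X ^ (i : ℕ)).degree < D.h.degree := by
    rw [D.degree_h]
    exact degree_sum_fin_lt w
  rw [← map_sum]
  change (AdjoinRoot.modByMonicHom D.monic_h (AdjoinRoot.mk D.h _)).coeff s = w s
  rw [AdjoinRoot.modByMonicHom_mk, (modByMonic_eq_self_iff D.monic_h).2 hdeg]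
  simp [coeff_X_pow, Fin.val_inj]

theorem exists_eq_p_mul [Fact p.Prime] {x : D.GR}
    (hx : ∀ s : Fin r, redHom p (D.grCoord s x) = 0) : ∃ y, x = p * y := by
  choose c hc using fun s => (redHom_eq_zero_iff p _).1 (hx s)
  refine ⟨∑ s : Fin r, AdjoinRoot.mk D.h (C (c s) * X ^ (s : ℕ)), ?_⟩
  rw [D.eq_sum_grCoord x, Finset.mul_sum]
  refine Finset.sum_congr rfl fun s _ => ?_
  rw [hc s, C_mul, mul_assoc, map_mul]
  simp

theorem eq_zero_of_grCoord [Fact p.Prime] {x : D.GR}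
    (hx : ∀ s : Fin r, D.grCoord s x = 0) : x = 0 := by
  rw [D.eq_sum_grCoord x]
  exact Finset.sum_eq_zero fun s _ => by rw [hx s, C_0, zero_mul, map_zero]

theorem coordX_mk (i : Fin t) (s : Fin r) (f : D.GR[X]) :
    D.coordX i s (Ideal.Quotient.mk D.ideal f) = D.grCoord s (D.remCoeff i f) := rfl

theorem coordY_mk (j : Fin (k - t)) (s : Fin r) (f : D.GR[X]) :
    D.coordY j s (Ideal.Quotient.mk D.ideal f) =
      redHom p (D.grCoord s (D.remCoeff (t + j) f)) := rfl

/-- The remainder modulo g has zero coefficients below degree t and coefficients divisible by p from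
there on, so it is a multiple of p y ^ t. -/
theorem eq_zero_of_coord [Fact p.Prime] {a : D.Ring} (hX : ∀ i s, D.coordX i s a = 0)
    (hY : ∀ j s, D.coordY j s a = 0) : a = 0 := by
  have := D.nontrivial_GR
  obtain ⟨f, rfl⟩ := Ideal.Quotient.mk_surjective a
  rw [Ideal.Quotient.eq_zero_iff_mem, ← modByMonic_add_div f D.g]
  refine Ideal.add_mem _ ?_ (Ideal.mul_mem_right _ _ (Ideal.subset_span (Or.inl rfl)))
  have hdeg : (f %ₘ D.g).degree < (k : WithBot ℕ) := by
    rw [← D.degree_g]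
    exact degree_modByMonic_lt _ D.monic_g
  rw [eq_sum_range_of_degree_lt hdeg]
  refine Ideal.sum_mem _ fun i hi => ?_
  rcases lt_or_ge i t with hit | hit
  · have : (f %ₘ D.g).coeff i = 0 := D.eq_zero_of_grCoord fun s => hX ⟨i, hit⟩ s
    rw [this, C_0, zero_mul]
    exact Ideal.zero_mem _
  · obtain ⟨j, rfl⟩ := Nat.exists_eq_add_of_le hit
    rw [Finset.mem_range] at hi
    obtain ⟨y, hy⟩ := D.exists_eq_p_mul (x := (f %ₘ D.g).coeff (t + j)) fun s =>
      hY ⟨j, by omega⟩ s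
    rw [hy, C_mul, pow_add, show C (p : D.GR) * C y * (X ^ t * X ^ j) =
      C (p : D.GR) * X ^ t * (C y * X ^ j) by ring]
    exact Ideal.mul_mem_right _ _ (Ideal.subset_span (Or.inr rfl))

/-- A polynomial of degree below k is its own remainder, so its coefficients may be prescribed; from
degree t on, arbitrary lifts from Z/p to Z/p² serve. -/
theorem exists_coord_eq [Fact p.Prime] (u : Fin t → Fin r → ZMod (p ^ 2))
    (v : Fin (k - t) → Fin r → ZMod p) :
    ∃ a, (∀ i s, D.coordX i s a = u i s) ∧ ∀ j s, D.coordY j s a = v j s := by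
  have := D.nontrivial_GR
  choose v' hv' using fun j s => redHom_surjective p (v j s)
  let w : Fin k → Fin r → ZMod (p ^ 2) := fun i s =>
    if hi : (i : ℕ) < t then u ⟨i, hi⟩ s else v' ⟨i - t, by omega⟩ s
  let β : Fin k → D.GR := fun i => ∑ s : Fin r, AdjoinRoot.mk D.h (C (w i s) * X ^ (s : ℕ))
  have hrem : ∀ i : Fin k, D.remCoeff i (∑ i : Fin k, C (β i) * X ^ (i : ℕ)) = β i := by
    intro i
    have hdeg : (∑ i : Fin k, C (β i) * X ^ (i : ℕ)).degree < D.g.degree := by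
      rw [D.degree_g]
      exact degree_sum_fin_lt β
    change ((∑ i : Fin k, C (β i) * X ^ (i : ℕ)) %ₘ D.g).coeff i = β i
    rw [(modByMonic_eq_self_iff D.monic_g).2 hdeg]
    simp [coeff_X_pow, Fin.val_inj]
  have htk := D.t_le_k
  refine ⟨Ideal.Quotient.mk D.ideal (∑ i : Fin k, C (β i) * X ^ (i : ℕ)), fun i s => ?_,
    fun j s => ?_⟩
  · rw [D.coordX_mk, hrem ⟨i, by omega⟩, D.grCoord_sum]
    exact dif_pos i.2
  · rw [D.coordY_mk, hrem ⟨t + j, by omega⟩, D.grCoord_sum, ← hv']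
    congr 1
    refine (dif_neg (by simp)).trans ?_
    simp

/-- An indexing of the coordinates of vectors over the ring. -/
noncomputable def indexEquiv (N r t : ℕ) : Fin (N * r * t) ≃ Fin N × Fin t × Fin r :=
  (Fintype.equivFinOfCardEq (by simp; ring)).symm

/-- All coordinates of a vector over the ring. -/
noncomputable def coordHom (N : ℕ) : (Fin N → D.Ring) →+
    (Fin (N * r * t) → ZMod (p ^ 2)) × (Fin (N * r * (k - t)) → ZMod p) where
  toFun d := (fun l => D.coordX (indexEquiv N r t l).2.1 (indexEquiv N r t l).2.2
      (d (indexEquiv N r t l).1),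
    fun l => D.coordY (indexEquiv N r (k - t) l).2.1 (indexEquiv N r (k - t) l).2.2
      (d (indexEquiv N r (k - t) l).1))
  map_zero' := by ext <;> simp
  map_add' d d' := by ext <;> simp

theorem coordHom_bijective [Fact p.Prime] (N : ℕ) : Function.Bijective (D.coordHom N) := by
  constructor
  · rw [injective_iff_map_eq_zero]
    intro d hd
    rw [Prod.ext_iff] at hd
    funext n
    refine D.eq_zero_of_coord (fun i s => ?_) fun j s => ?_
    · have := congrFun hd.1 ((indexEquiv N r t).symm (n, i, s))
      simpa [coordHom] using this
    · have := congrFun hd.2 ((indexEquiv N r (k - t)).symm (n, j, s))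
      simpa [coordHom] using this
  · rintro ⟨u, v⟩
    choose d hX hY using fun n => D.exists_coord_eq
      (fun i s => u ((indexEquiv N r t).symm (n, i, s)))
      (fun i s => v ((indexEquiv N r (k - t)).symm (n, i, s)))
    refine ⟨d, Prod.ext (funext fun l => ?_) (funext fun l => ?_)⟩
    · exact (hX _ _ _).trans (congrArg u (Equiv.symm_apply_apply _ l))
    · exact (hY _ _ _).trans (congrArg v (Equiv.symm_apply_apply _ l))

attribute [local instance] zmodAlgebra

/-- The product is a power of ξ. A factor of ξ ^ p contributes p times a residue modulo p, which is
the embedding of Z/p into Z/p², so the exponent modulo p² is the value of the mixed form. -/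
theorem prod_chi_eq_one_iff [Fact p.Prime] {ξ : ℂ} (hξ : IsPrimitiveRoot ξ (p ^ 2)) {N : ℕ}
    (d c : Fin N → D.Ring) : ∏ l, D.chi ξ (d l) (c l) = 1 ↔
      mixedForm (zmodLinearEmbed p) _ _ (D.coordHom N d) (D.coordHom N c) = 0 := by
  have h1 : ∏ l, D.chi ξ (d l) (c l) = ξ ^ (∑ l : Fin N, ∑ s : Fin r,
      (∑ i : Fin t, (D.coordX i s (d l) * D.coordX i s (c l)).val +
        ∑ j : Fin (k - t), p * (D.coordY j s (d l) * D.coordY j s (c l)).val)) := by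
    simp only [chi, ← Finset.prod_pow_eq_pow_sum, pow_add, pow_mul]
  rw [h1, hξ.pow_eq_one_iff_dvd, ← ZMod.natCast_eq_zero_iff]
  apply Eq.congr _ rfl
  have h2 : ∀ x : ZMod p, ((p * x.val : ℕ) : ZMod (p ^ 2)) = zmodEmbed p x := by
    intro x
    conv_rhs => rw [← ZMod.natCast_zmod_val x, zmodEmbed_natCast]
    push_cast
    rfl
  rw [mixedForm_apply, zmodLinearEmbed_apply]
  have h3 : (D.coordHom N d).1 ⬝ᵥ (D.coordHom N c).1 =
      ∑ l : Fin N, ∑ s : Fin r, ∑ i : Fin t, D.coordX i s (d l) * D.coordX i s (c l) := by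
    refine ((indexEquiv N r t).sum_comp fun x =>
      D.coordX x.2.1 x.2.2 (d x.1) * D.coordX x.2.1 x.2.2 (c x.1)).trans ?_
    rw [Fintype.sum_prod_type]
    exact Finset.sum_congr rfl fun l _ => Fintype.sum_prod_type_right _
  have h4 : (D.coordHom N d).2 ⬝ᵥ (D.coordHom N c).2 =
      ∑ l : Fin N, ∑ s : Fin r, ∑ j : Fin (k - t), D.coordY j s (d l) * D.coordY j s (c l) := by
    refine ((indexEquiv N r (k - t)).sum_comp fun x =>
      D.coordY x.2.1 x.2.2 (d x.1) * D.coordY x.2.1 x.2.2 (c x.1)).trans ?_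
    rw [Fintype.sum_prod_type]
    exact Finset.sum_congr rfl fun l _ => Fintype.sum_prod_type_right _
  rw [h3, h4]
  simp only [Nat.cast_sum, Nat.cast_add, h2, ZMod.natCast_zmod_val, map_sum,
    Finset.sum_add_distrib]

/-- Additive codes correspond to codes over a mixed alphabet. -/
noncomputable def codeEquiv [Fact p.Prime] (N : ℕ) : AddSubgroup (Fin N → D.Ring) ≃
    Submodule (ZMod (p ^ 2)) ((Fin (N * r * t) → ZMod (p ^ 2)) ×
      (Fin (N * r * (k - t)) → ZMod p)) :=
  (AddEquiv.ofBijective (D.coordHom N) (D.coordHom_bijective N)).mapAddSubgroup.toEquiv.trans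
    -- In a group killed by p², additive subgroups and submodules over Z/p² are the same.
    (AddSubgroup.toZModSubmodule (p ^ 2)).toEquiv

theorem isSelfDual_iff [Fact p.Prime] {ξ : ℂ} (hξ : IsPrimitiveRoot ξ (p ^ 2)) {N : ℕ}
    (C : AddSubgroup (Fin N → D.Ring)) :
    D.IsSelfDual ξ C ↔ IsMixedSelfDual (zmodLinearEmbed p) (D.codeEquiv N C) := by
  let φ := AddEquiv.ofBijective (D.coordHom N) (D.coordHom_bijective N)
  have hmem : ∀ d, φ d ∈ D.codeEquiv N C ↔ d ∈ C := fun d =>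
    AddSubgroup.mem_map_iff_mem φ.injective
  rw [IsSelfDual, Set.ext_iff, IsMixedSelfDual, φ.surjective.forall]
  refine forall_congr' fun d => ?_
  rw [hmem, φ.surjective.forall]
  refine iff_congr Iff.rfl (forall_congr' fun c => ?_)
  rw [hmem]
  exact imp_congr Iff.rfl (D.prod_chi_eq_one_iff hξ d c)

end EisensteinData

end MixedCodes

/-! ### Transfer of the mixed-alphabet results to both families of codes -/

theorem theorem4p4 :
    -- self-dual codes over the mixed alphabet
    (∀ (R : Type*) [CommRing R] [Finite R] [IsLocalRing R] (γ : R),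
      MixedCodes.IsChainRingOfIndexTwo R γ →
      Odd (Nat.card (IsLocalRing.ResidueField R)) →
      ∀ N₁ N₂ : ℕ,
        ((∃ C : Submodule R (MixedCodes.MixedSpace R N₁ N₂), MixedCodes.IsEuclSelfDual γ C) ↔
          (Even N₂ ∧ IsSquare ((-1 : IsLocalRing.ResidueField R) ^ (N₂ / 2)))) ∧
        (Even N₂ → IsSquare ((-1 : IsLocalRing.ResidueField R) ^ (N₂ / 2)) →
          Nat.card {C : Submodule R (MixedCodes.MixedSpace R N₁ N₂) //
              MixedCodes.IsEuclSelfDual γ C} =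
            ∑ k₀ ∈ Finset.range (N₁ / 2 + 1),
              MixedCodes.sigma (IsLocalRing.ResidueField R) N₁ k₀ *
                MixedCodes.sigma (IsLocalRing.ResidueField R) N₂ (N₂ / 2) *
                Nat.card (IsLocalRing.ResidueField R) ^ (k₀ * (N₂ + k₀ - 1) / 2))) ∧
    -- self-dual additive codes
    (∀ (p r k t : ℕ) [Fact p.Prime], p ≠ 2 →
      ∀ (D : MixedCodes.EisensteinData p r k t) (ξ : ℂ), IsPrimitiveRoot ξ (p ^ 2) →
      ∀ N : ℕ,
        ((∃ C : AddSubgroup (Fin N → D.Ring), D.IsSelfDual ξ C) ↔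
          (Even (N * r * (k - t)) ∧ IsSquare ((-1 : ZMod p) ^ (N * r * (k - t) / 2)))) ∧
        (Even (N * r * (k - t)) → IsSquare ((-1 : ZMod p) ^ (N * r * (k - t) / 2)) →
          Nat.card {C : AddSubgroup (Fin N → D.Ring) // D.IsSelfDual ξ C} =
            ∑ k₀ ∈ Finset.range (N * r * t / 2 + 1),
              MixedCodes.sigma (ZMod p) (N * r * t) k₀ *
                MixedCodes.sigma (ZMod p) (N * r * (k - t)) (N * r * (k - t) / 2) *
                p ^ (k₀ * (N * r * (k - t) + k₀ - 1) / 2))) ∧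
    -- the numbers `sigma` are given by the closed formula
    (∀ (K : Type*) [Field K] [Finite K], Odd (Nat.card K) →
      ∀ n s : ℕ, (MixedCodes.sigma K n s : ℚ) = MixedCodes.sigmaFormula K n s) := by
  refine ⟨?_, ?_, fun K _ _ hK n s => MixedCodes.sigma_eq_sigmaFormula hK n s⟩
  · intro R _ _ _ γ hR hK N₁ N₂
    have : Finite (IsLocalRing.ResidueField R) :=
      Finite.of_surjective _ IsLocalRing.residue_surjective
    refine ⟨?_, fun hN _ => ?_⟩
    · rw [← hR.isMixedAlphabet.exists_selfDual_iff hK N₁ N₂]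
      exact exists_congr fun C => MixedCodes.isEuclSelfDual_iff hR C
    · obtain ⟨m, rfl⟩ := even_iff_two_dvd.1 hN
      rw [Nat.mul_div_cancel_left _ two_pos, ← hR.isMixedAlphabet.card_selfDual
        (MixedCodes.two_ne_zero_of_odd_card hK) N₁ m]
      exact Nat.card_congr (Equiv.subtypeEquivRight fun C => MixedCodes.isEuclSelfDual_iff hR C)
  · intro p r k t _ hp D ξ hξ N
    let := MixedCodes.zmodAlgebra p
    have hK : Odd (Nat.card (ZMod p)) := by
      rw [Nat.card_zmod]
      exact (Fact.out : p.Prime).odd_of_ne_two hp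
    have h := MixedCodes.isMixedAlphabet_zmod p
    refine ⟨?_, fun hN _ => ?_⟩
    · rw [← h.exists_selfDual_iff hK (N * r * t), ← (D.codeEquiv N).exists_congr_right]
      exact exists_congr fun C => D.isSelfDual_iff hξ C
    · obtain ⟨m, hm⟩ := even_iff_two_dvd.1 hN
      have h1 := h.card_selfDual (MixedCodes.two_ne_zero_of_odd_card hK) (N * r * t) m
      rw [← hm, Nat.card_zmod] at h1
      rw [show N * r * (k - t) / 2 = m by omega, ← h1]
      exact Nat.card_congr ((D.codeEquiv N).subtypeEquiv fun C => D.isSelfDual_iff hξ C)
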